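/- Let $q,x,y,z\in\mathbb{C}$ with $q\neq 0$, $|q|<|y|<1$, $|q|<|z|<1$, and let $x$ be neither zero nor an integral power of $q$. Write $(a;q)_\infty=\prod_{i\ge 0}(1-q^i a)$ and $(a_1,\dots,a_n;q)_\infty=(a_1;q)_\infty\cdots(a_n;q)_\infty$. Then \begin{align*} \Big(\sum_{s,t\ge 0}-\sum_{s,t<0}\Big)\frac{q^{st}y^sz^t}{1-xq^{s+t}} ={}&\frac{(yz,q^2/yz;q^2)_\infty}{(y,z,q/y,q/z;q)_\infty}\frac{(q;q)_\infty^2}{(q^2;q^2)_\infty}\sum_{k\in\mathbb{Z}}\frac{(-1)^kq^{k^2}(yz)^k}{1+q^{2k}x}\\ &+\frac{(xy,q^2/xy;q^2)_\infty}{(x,y,q/x,q/y;q)_\infty}\frac{(q;q)_\infty^2}{(q^2;q^2)_\infty}\sum_{k\in\mathbb{Z}}\frac{(-1)^kq^{k^2}(xy)^k}{1+q^{2k}z}\\ &-2\,\frac{(q^2;q^2)_\infty^3}{(x,y,z,q/x,q/y,q/z;q)_\infty}\,\frac{(xy,xz,yz,q^2/xy,q^2/xz,q^2/yz;q^2)_\infty}{(-x,-y,-z,-q^2/x,-q^2/y,-q^2/z;q^2)_\infty}\\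 &+\frac{(xz,q^2/xz;q^2)_\infty}{(x,z,q/x,q/z;q)_\infty}\frac{(q;q)_\infty^2}{(q^2;q^2)_\infty}\sum_{k\in\mathbb{Z}}\frac{(-1)^kq^{k^2}(xz)^k}{1+q^{2k}y}, \end{align*} where all the series converge absolutely. If $x=-q^{2k}$ for some $k\in\mathbb{Z}$, the first and third terms on the right are undefined; there the right-hand side has a removable singularity as a function of $x$, and is understood as its limit. -/

import Mathlib

open Filter Topology

noncomputable section

namespace Kronecker

/-- The infinite `q`-Pochhammer symbol `(a; q)_∞ = ∏_{i ≥ 0} (1 - q ^ i a)`. -/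
def qPoch (a q : ℂ) : ℂ := ∏' i : ℕ, (1 - q ^ i * a)

/-- The product defining `(a; q)_∞` converges whenever `|q| < 1`. -/
theorem multipliable_qPoch (a : ℂ) {q : ℂ} (hq : ‖q‖ < 1) :
    Multipliable fun i : ℕ => 1 - q ^ i * a := by
  have h : Summable fun i : ℕ => ‖-(q ^ i * a)‖ := by
    simpa [norm_mul, norm_pow] using
      (summable_geometric_of_lt_one (norm_nonneg q) hq).mul_right ‖a‖
  simpa [sub_eq_add_neg] using multipliable_one_add_of_summable h

/-- The multi-argument symbol `(a₁, …, aₙ; q)_∞ = (a₁; q)_∞ ⋯ (aₙ; q)_∞`. -/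
def qPochs (as : List ℂ) (q : ℂ) : ℂ := (as.map fun a => qPoch a q).prod

/-- The summand `q ^ (s t) y ^ s z ^ t / (1 - x q ^ (s + t))` for integers `s`, `t`. -/
def term (q x y z : ℂ) (s t : ℤ) : ℂ :=
  q ^ (s * t) * y ^ s * z ^ t / (1 - x * q ^ (s + t))

/-- The summands with `s, t ≥ 0`. -/
def termNonneg (q x y z : ℂ) (p : ℕ × ℕ) : ℂ := term q x y z (p.1 : ℤ) (p.2 : ℤ)

/-- The summands with `s, t < 0`, where `s = -(m + 1)` and `t = -(n + 1)` with `m, n ≥ 0`. -/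
def termNeg (q x y z : ℂ) (p : ℕ × ℕ) : ℂ :=
  term q x y z (-((p.1 : ℤ) + 1)) (-((p.2 : ℤ) + 1))

/-- `(∑_{s,t ≥ 0} - ∑_{s,t < 0}) q ^ (s t) y ^ s z ^ t / (1 - x q ^ (s + t))`. -/
def doubleSum (q x y z : ℂ) : ℂ :=
  (∑' p : ℕ × ℕ, termNonneg q x y z p) - (∑' p : ℕ × ℕ, termNeg q x y z p)

/-- The summand `(-1) ^ k q ^ (k²) u ^ k / (1 + q ^ (2 k) v)` of the Lerch-type sum. -/
def lerchTerm (q u v : ℂ) (k : ℤ) : ℂ :=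
  (-1) ^ k * q ^ (k ^ 2) * u ^ k / (1 + q ^ (2 * k) * v)

/-- The term
`(ab, q²/ab; q²)_∞ / (a, b, q/a, q/b; q)_∞ * (q; q)_∞² / (q²; q²)_∞
  * ∑_{k ∈ ℤ} (-1) ^ k q ^ (k²) (ab) ^ k / (1 + q ^ (2 k) c)`. -/
def lerchPart (q a b c : ℂ) : ℂ :=
  qPochs [a * b, q ^ 2 / (a * b)] (q ^ 2) / qPochs [a, b, q / a, q / b] q
    * (qPoch q q ^ 2 / qPoch (q ^ 2) (q ^ 2)) * ∑' k : ℤ, lerchTerm q (a * b) c k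

/-- The quotient of theta products in `q` and `q²` (without the factor `-2`). -/
def thetaPart (q x y z : ℂ) : ℂ :=
  qPoch (q ^ 2) (q ^ 2) ^ 3 / qPochs [x, y, z, q / x, q / y, q / z] q
    * (qPochs [x * y, x * z, y * z, q ^ 2 / (x * y), q ^ 2 / (x * z), q ^ 2 / (y * z)] (q ^ 2)
      / qPochs [-x, -y, -z, -q ^ 2 / x, -q ^ 2 / y, -q ^ 2 / z] (q ^ 2))

/-- The closed form of the double sum. -/
def closedForm (q x y z : ℂ) : ℂ :=
  lerchPart q y z x + lerchPart q x y z - 2 * thetaPart q x y z + lerchPart q x z y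

end Kronecker

end

/-
Write `θ(a) = (a, q/a; q)_∞` and `κ(a, b) = (q; q)_∞² θ(ab) / (θ(a) θ(b))`, which by Kronecker's
identity is `∑ bˢ / (1 - a qˢ)`, summed over `s ∈ ℤ`. As functions `f` of `x`, both sides of the
theorem satisfy `f(q² x) = κ(y, z) + (q/yz) x (f(x) - κ(x, y) - κ(x, z))`, so their difference `g`
satisfies `g(q² x) = (q/yz) x g(x)`. Modulo powers of `q²`, the only possible poles of `g` are
simple ones at `1`, `q` and `-1`. The residue at `-1` vanishes by evaluating theta constants, those
at `1` and `q` by a formula for how a normalised Lerch sum changes when both its arguments are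
scaled, itself obtained by the same residue argument. So `g` is holomorphic on the punctured plane,
and the functional equation forces `g = 0`.
-/

noncomputable section

namespace AppellLerch

open Kronecker

section SimplePole

/-- `g` has at `a` at most a simple pole, with residue `r`. The value `g a` is irrelevant, so that
identities between meromorphic functions need not be checked at the poles, where division
returns `0`. -/
def HasSimplePoleAt (g : ℂ → ℂ) (r a : ℂ) : Prop :=
  ∃ h : ℂ → ℂ, AnalyticAt ℂ h a ∧ h a = r ∧ ∀ᶠ x in 𝓝[≠] a, g x = h x / (x - a)

variable {f g u : ℂ → ℂ} {a b r s : ℂ}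

theorem hasSimplePoleAt_of_analyticAt (hg : AnalyticAt ℂ g a) : HasSimplePoleAt g 0 a := by
  refine ⟨fun x => (x - a) * g x, by fun_prop, by simp, ?_⟩
  filter_upwards [self_mem_nhdsWithin] with x hx
  rw [mul_div_cancel_left₀ _ (sub_ne_zero.2 hx)]

namespace HasSimplePoleAt

theorem congr (hg : HasSimplePoleAt g r a) (h : f =ᶠ[𝓝[≠] a] g) : HasSimplePoleAt f r a := by
  obtain ⟨k, hk, hr, he⟩ := hg
  exact ⟨k, hk, hr, h.trans he⟩

theorem add (hf : HasSimplePoleAt f r a) (hg : HasSimplePoleAt g s a) :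
    HasSimplePoleAt (fun x => f x + g x) (r + s) a := by
  obtain ⟨h, hh, rfl, hfh⟩ := hf
  obtain ⟨k, hk, rfl, hgk⟩ := hg
  refine ⟨fun x => h x + k x, hh.add hk, rfl, ?_⟩
  filter_upwards [hfh, hgk] with x hfx hgx
  rw [hfx, hgx, add_div]

theorem analytic_mul (hu : AnalyticAt ℂ u a) (hg : HasSimplePoleAt g r a) :
    HasSimplePoleAt (fun x => u x * g x) (u a * r) a := by
  obtain ⟨h, hh, rfl, he⟩ := hg
  refine ⟨fun x => u x * h x, hu.mul hh, rfl, ?_⟩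
  filter_upwards [he] with x hx
  rw [hx, mul_div_assoc]

theorem const_mul (c : ℂ) (hg : HasSimplePoleAt g r a) :
    HasSimplePoleAt (fun x => c * g x) (c * r) a :=
  analytic_mul (u := fun _ => c) analyticAt_const hg

theorem sub (hf : HasSimplePoleAt f r a) (hg : HasSimplePoleAt g s a) :
    HasSimplePoleAt (fun x => f x - g x) (r - s) a := by
  simpa only [neg_one_mul, ← sub_eq_add_neg] using hf.add (hg.const_mul (-1))

end HasSimplePoleAt

theorem tendsto_const_mul_nhdsNE (hb : b ≠ 0) :
    Tendsto (fun x => b * x) (𝓝[≠] a) (𝓝[≠] (b * a)) := by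
  refine tendsto_nhdsWithin_of_tendsto_nhds_of_eventually_within _
    (((continuous_const_mul b).tendsto a).mono_left nhdsWithin_le_nhds) ?_
  filter_upwards [self_mem_nhdsWithin] with x hx
  simpa [hb] using hx

namespace HasSimplePoleAt

theorem comp_const_mul (hb : b ≠ 0) (hg : HasSimplePoleAt g r (b * a)) :
    HasSimplePoleAt (fun x => g (b * x)) (r / b) a := by
  obtain ⟨h, hh, rfl, he⟩ := hg
  refine ⟨fun x => h (b * x) / b, ?_, rfl, ?_⟩
  · exact (hh.comp (f := fun x => b * x) (by fun_prop)).div_const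
  · filter_upwards [(tendsto_const_mul_nhdsNE hb).eventually he] with x hx
    rw [hx, ← mul_sub, div_div]

theorem comp_const_mul_iff_zero (hb : b ≠ 0) :
    HasSimplePoleAt (fun x => g (b * x)) 0 a ↔ HasSimplePoleAt g 0 (b * a) := by
  refine ⟨fun h => ?_, fun h => by simpa using h.comp_const_mul hb⟩
  have h' := comp_const_mul (inv_ne_zero hb) (a := b * a) (by rwa [inv_mul_cancel_left₀ hb])
  simpa [mul_inv_cancel_left₀ hb] using h'

theorem exists_analyticAt (hg : HasSimplePoleAt g 0 a) :
    ∃ E : ℂ → ℂ, AnalyticAt ℂ E a ∧ g =ᶠ[𝓝[≠] a] E := by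
  obtain ⟨h, hh, h0, he⟩ := hg
  obtain ⟨s, hs⟩ := hh
  refine ⟨dslope h a, hs.has_fpower_series_dslope_fslope.analyticAt, ?_⟩
  filter_upwards [he, self_mem_nhdsWithin] with x hx hxa
  rw [hx, dslope_of_ne _ hxa, slope_def_field, h0, sub_zero]

theorem tendsto_limUnder (hg : HasSimplePoleAt g 0 a) :
    Tendsto g (𝓝[≠] a) (𝓝 (limUnder (𝓝[≠] a) g)) := by
  obtain ⟨E, hE, he⟩ := hg.exists_analyticAt
  exact tendsto_nhds_limUnder
    ⟨E a, (hE.continuousAt.tendsto.mono_left nhdsWithin_le_nhds).congr' he.symm⟩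

theorem analyticAt_limUnder (hg : HasSimplePoleAt g 0 a) :
    AnalyticAt ℂ (fun x => limUnder (𝓝[≠] x) g) a := by
  obtain ⟨E, hE, he⟩ := hg.exists_analyticAt
  refine hE.congr ?_
  have heq : ∀ᶠ x in 𝓝 a, x ≠ a → g x = E x := eventually_nhdsWithin_iff.1 he
  filter_upwards [heq.eventually_nhds, hE.eventually_analyticAt] with x hx hEx
  have hgE : g =ᶠ[𝓝[≠] x] E := by
    rcases eq_or_ne x a with rfl | hxa
    · exact he
    · filter_upwards [hx.filter_mono nhdsWithin_le_nhds,
        (isOpen_ne.eventually_mem hxa).filter_mono nhdsWithin_le_nhds] with w hw hwa using hw hwa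
  exact ((hEx.continuousAt.tendsto.mono_left nhdsWithin_le_nhds).congr' hgE.symm).limUnder_eq.symm

end HasSimplePoleAt

end SimplePole

section Quasiperiodic

variable {p : ℂ} {g h H φ ψ : ℂ → ℂ}

/-- The annulus `‖p‖ r ≤ ‖x‖ ≤ r` is compact and meets every orbit of `x ↦ p * x` in the punctured
ball. -/
theorem exists_norm_le_of_norm_mul_le (hp0 : p ≠ 0) (hp1 : ‖p‖ < 1) {r : ℝ} (hr : 0 < r)
    (hH : ∀ x, x ≠ 0 → ContinuousAt H x) (hle : ∀ x, x ≠ 0 → ‖x‖ ≤ r → ‖H (p * x)‖ ≤ ‖H x‖) :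
    ∃ M, ∀ x, x ≠ 0 → ‖x‖ ≤ r → ‖H x‖ ≤ M := by
  have hpn : 0 < ‖p‖ := norm_pos_iff.2 hp0
  have hcomp : IsCompact (Metric.closedBall (0 : ℂ) r \ Metric.ball 0 (‖p‖ * r)) :=
    (isCompact_closedBall _ _).diff Metric.isOpen_ball
  obtain ⟨M, hM⟩ := hcomp.exists_bound_of_continuousOn (f := H) fun x hx => by
    refine (hH x ?_).continuousWithinAt
    rintro rfl
    exact hx.2 (Metric.mem_ball_self (by positivity))
  have hiter : ∀ (n : ℕ) (x : ℂ), x ≠ 0 → ‖x‖ ≤ r → ‖H (p ^ n * x)‖ ≤ ‖H x‖ := by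
    intro n x hx hxr
    induction n with
    | zero => simp
    | succ n ih =>
      refine le_trans ?_ ih
      rw [pow_succ', mul_assoc]
      refine hle _ (mul_ne_zero (pow_ne_zero _ hp0) hx) ?_
      rw [norm_mul, norm_pow]
      exact (mul_le_of_le_one_left (norm_nonneg x) (pow_le_one₀ hpn.le hp1.le)).trans hxr
  refine ⟨M, fun x hx hxr => ?_⟩
  obtain ⟨n, hn1, hn2⟩ := exists_nat_pow_near_of_lt_one (x := ‖x‖ / r)
    (div_pos (norm_pos_iff.2 hx) hr) ((div_le_one hr).2 hxr) hpn hp1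
  have hpn0 : p ^ n ≠ 0 := pow_ne_zero _ hp0
  have hpp : 0 < ‖p‖ ^ n := by positivity
  have hxn : ‖x / p ^ n‖ = ‖x‖ / ‖p‖ ^ n := by rw [norm_div, norm_pow]
  have hle_r : ‖x / p ^ n‖ ≤ r := by
    rw [hxn, div_le_iff₀ hpp, mul_comm]
    exact (div_le_iff₀ hr).1 hn2
  have hge : ‖p‖ * r ≤ ‖x / p ^ n‖ := by
    rw [hxn, le_div_iff₀ hpp]
    calc ‖p‖ * r * ‖p‖ ^ n = ‖p‖ ^ (n + 1) * r := by ring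
      _ ≤ ‖x‖ := ((lt_div_iff₀ hr).1 hn1).le
  calc ‖H x‖ = ‖H (p ^ n * (x / p ^ n))‖ := by rw [mul_div_cancel₀ _ hpn0]
    _ ≤ ‖H (x / p ^ n)‖ := hiter n _ (div_ne_zero hx hpn0) hle_r
    _ ≤ M := hM _ ⟨by simpa using hle_r, by simpa using hge⟩

/-- The order `n` of vanishing at `0` would satisfy `ψ 0 = p ^ n`. -/
theorem eventually_eq_zero_of_quasiperiodic (hH : AnalyticAt ℂ H 0)
    (hψ : ContinuousAt ψ 0) (hpow : ∀ n : ℕ, ψ 0 ≠ p ^ n)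
    (hfe : ∀ᶠ x in 𝓝[≠] 0, H (p * x) = ψ x * H x) : ∀ᶠ x in 𝓝 0, H x = 0 := by
  by_contra hcon
  obtain ⟨n, u, hu, hu0, hn⟩ := hH.exists_eventuallyEq_pow_smul_nonzero_iff.2 hcon
  have hmul : Tendsto (fun x : ℂ => p * x) (𝓝 0) (𝓝 0) := by
    simpa using (continuous_const_mul p).tendsto (0 : ℂ)
  have heq : ∀ᶠ x in 𝓝[≠] (0 : ℂ), p ^ n * u (p * x) = ψ x * u x := by
    filter_upwards [hn.filter_mono nhdsWithin_le_nhds,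
      (hmul.eventually hn).filter_mono nhdsWithin_le_nhds, hfe, self_mem_nhdsWithin]
      with x hHx hHpx hfx hx
    rw [hHx, hHpx] at hfx
    simp only [sub_zero, smul_eq_mul, mul_pow] at hfx
    exact mul_left_cancel₀ (pow_ne_zero n hx) (by linear_combination hfx)
  have hl : Tendsto (fun x => p ^ n * u (p * x)) (𝓝[≠] 0) (𝓝 (p ^ n * u 0)) :=
    ((hu.continuousAt.tendsto.comp hmul).const_mul _).mono_left nhdsWithin_le_nhds
  have hr : Tendsto (fun x => ψ x * u x) (𝓝[≠] 0) (𝓝 (ψ 0 * u 0)) :=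
    (hψ.tendsto.mul hu.continuousAt.tendsto).mono_left nhdsWithin_le_nhds
  exact hpow n (mul_right_cancel₀ hu0 (tendsto_nhds_unique (hl.congr' heq) hr)).symm

theorem eq_zero_of_eventually_of_quasiperiodic (hp0 : p ≠ 0) (hp1 : ‖p‖ < 1)
    (hφ0 : ∀ x, x ≠ 0 → φ x ≠ 0) (hfe : ∀ x, x ≠ 0 → h (p * x) = φ x * h x)
    (hz : ∀ᶠ x in 𝓝[≠] 0, h x = 0) {x : ℂ} (hx : x ≠ 0) : h x = 0 := by
  have hne (n : ℕ) : p ^ n * x ≠ 0 := mul_ne_zero (pow_ne_zero _ hp0) hx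
  have hback : ∀ n : ℕ, h (p ^ n * x) = 0 → h x = 0 := by
    intro n
    induction n with
    | zero => simp
    | succ n ih =>
      intro hn
      rw [pow_succ', mul_assoc, hfe _ (hne n)] at hn
      exact ih ((mul_eq_zero.1 hn).resolve_left (hφ0 _ (hne n)))
  have hlim : Tendsto (fun n : ℕ => p ^ n * x) atTop (𝓝[≠] 0) := by
    refine tendsto_nhdsWithin_of_tendsto_nhds_of_eventually_within _ ?_
      (Eventually.of_forall hne)
    simpa using (tendsto_pow_atTop_nhds_zero_of_norm_lt_one hp1).mul_const x
  obtain ⟨n, hn⟩ := (hlim.eventually hz).exists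
  exact hback n hn

theorem eq_zero_of_analyticAt_of_quasiperiodic (hp0 : p ≠ 0) (hp1 : ‖p‖ < 1)
    (hh : ∀ a, a ≠ 0 → AnalyticAt ℂ h a) (hφ : Continuous φ) (hφ0 : ∀ x, x ≠ 0 → φ x ≠ 0)
    (hs : ‖p * φ 0‖ < 1) (hpow : ∀ n : ℕ, φ 0 ≠ p ^ n)
    (hfe : ∀ x, x ≠ 0 → h (p * x) = φ x * h x) {x : ℂ} (hx : x ≠ 0) : h x = 0 := by
  -- the factor `x` makes the multiplier small, so that the singularity at `0` becomes removable
  set H : ℂ → ℂ := fun x => x * h x with hH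
  have hHan : ∀ a, a ≠ 0 → AnalyticAt ℂ H a := fun a ha => analyticAt_id.mul (hh a ha)
  have hHfe : ∀ x, x ≠ 0 → H (p * x) = p * φ x * H x := by
    intro x hx
    simp only [hH, hfe x hx]
    ring
  obtain ⟨r, hr, hrφ⟩ : ∃ r > 0, ∀ x : ℂ, ‖x‖ ≤ r → ‖p * φ x‖ < 1 := by
    simpa using Metric.nhds_basis_closedBall.eventually_iff.1
      ((continuous_const.mul hφ).norm.continuousAt.eventually_lt continuousAt_const hs)
  obtain ⟨M, hM⟩ := exists_norm_le_of_norm_mul_le hp0 hp1 hr (fun x hx => (hHan x hx).continuousAt)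
    fun x hx hxr => by
      rw [hHfe x hx, norm_mul]
      exact mul_le_of_le_one_left (norm_nonneg _) (hrφ x hxr).le
  have hball : Metric.ball (0 : ℂ) r ∈ 𝓝 0 := Metric.ball_mem_nhds _ hr
  have hext : AnalyticAt ℂ (Function.update H 0 (limUnder (𝓝[≠] 0) H)) 0 := by
    refine (Complex.differentiableOn_update_limUnder_of_bddAbove hball
      (fun x hx => (hHan x hx.2).differentiableAt.differentiableWithinAt)
      ⟨M, ?_⟩).analyticAt hball
    rintro _ ⟨x, hx, rfl⟩
    exact hM x hx.2 (by simpa using (Metric.mem_ball.1 hx.1).le)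
  have hzero := eventually_eq_zero_of_quasiperiodic (p := p) (ψ := fun x => p * φ x) hext
    (continuousAt_const.mul hφ.continuousAt) (fun n hn => ?_) ?_
  · refine eq_zero_of_eventually_of_quasiperiodic hp0 hp1 hφ0 hfe ?_ hx
    filter_upwards [hzero.filter_mono nhdsWithin_le_nhds, self_mem_nhdsWithin] with w hw hw0
    rw [Function.update_of_ne hw0] at hw
    exact (mul_eq_zero.1 hw).resolve_left hw0
  · cases n with
    | zero => simp [hn] at hs
    | succ n => exact hpow n (mul_left_cancel₀ hp0 (by rw [hn, pow_succ']))
  · filter_upwards [self_mem_nhdsWithin] with w hw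
    rw [Function.update_of_ne hw, Function.update_of_ne (mul_ne_zero hp0 hw), hHfe w hw]

theorem HasSimplePoleAt.mul_left_iff_of_quasiperiodic (hp0 : p ≠ 0) {a : ℂ}
    (hφ : AnalyticAt ℂ φ a) (hφ0 : φ a ≠ 0)
    (hfe : ∀ᶠ x in 𝓝[≠] a, g (p * x) = φ x * g x) :
    HasSimplePoleAt g 0 (p * a) ↔ HasSimplePoleAt g 0 a := by
  rw [← comp_const_mul_iff_zero hp0]
  refine ⟨fun h => ?_, fun h => by simpa using (h.analytic_mul hφ).congr hfe⟩
  have h' := h.analytic_mul (hφ.inv hφ0)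
  rw [mul_zero] at h'
  refine h'.congr ?_
  filter_upwards [hfe, (hφ.continuousAt.eventually_ne hφ0).filter_mono nhdsWithin_le_nhds]
    with x hx hx0
  rw [hx, Pi.inv_apply, inv_mul_cancel_left₀ hx0]

theorem zpow_mul_iff_of_mul_iff (hp0 : p ≠ 0) {P : ℂ → Prop} (hP : ∀ a, a ≠ 0 → (P (p * a) ↔ P a))
    {a : ℂ} (ha : a ≠ 0) (n : ℤ) : P (p ^ n * a) ↔ P a := by
  induction n using Int.induction_on with
  | zero => simp
  | succ n ih =>
    rw [zpow_add_one₀ hp0, mul_comm (_ ^ _), mul_assoc,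
      hP _ (mul_ne_zero (zpow_ne_zero _ hp0) ha), ih]
  | pred n ih =>
    rw [← ih, ← hP _ (mul_ne_zero (zpow_ne_zero _ hp0) ha), ← mul_assoc, ← zpow_one_add₀ hp0]
    simp

/-- Liouville's theorem for the multiplier `φ`: `g` is meromorphic on the punctured plane, `S`
represents the possible poles modulo `x ↦ p * x`, and the residues vanish there. -/
theorem eq_zero_of_quasiperiodic (hp0 : p ≠ 0) (hp1 : ‖p‖ < 1) {S : Set ℂ}
    (hS : ∀ b ∈ S, HasSimplePoleAt g 0 b)
    (hg : ∀ a, a ≠ 0 → AnalyticAt ℂ g a ∨ ∃ b ∈ S, ∃ n : ℤ, a = p ^ n * b)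
    (hφ : ∀ a, AnalyticAt ℂ φ a) (hφ0 : ∀ x, x ≠ 0 → φ x ≠ 0)
    (hs : ‖p * φ 0‖ < 1) (hpow : ∀ n : ℕ, φ 0 ≠ p ^ n)
    (hfe : ∀ a, a ≠ 0 → ∀ᶠ x in 𝓝[≠] a, g (p * x) = φ x * g x) {x : ℂ} (hx : x ≠ 0)
    (hc : ContinuousAt g x) : g x = 0 := by
  have hpole : ∀ a, a ≠ 0 → HasSimplePoleAt g 0 a := by
    intro a ha
    rcases hg a ha with h | ⟨b, hb, n, rfl⟩
    · exact hasSimplePoleAt_of_analyticAt h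
    · refine (zpow_mul_iff_of_mul_iff hp0 (fun a ha => ?_) (right_ne_zero_of_mul ha) n).2 (hS b hb)
      exact HasSimplePoleAt.mul_left_iff_of_quasiperiodic hp0 (hφ a) (hφ0 a ha) (hfe a ha)
  have hlim := eq_zero_of_analyticAt_of_quasiperiodic hp0 hp1 (h := fun x => limUnder (𝓝[≠] x) g)
    (fun a ha => (hpole a ha).analyticAt_limUnder)
    (continuous_iff_continuousAt.2 fun a => (hφ a).continuousAt) hφ0 hs hpow
    (fun a ha => ?_) hx
  · exact (hc.tendsto.mono_left nhdsWithin_le_nhds).limUnder_eq.symm.trans hlim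
  · have hleft := (hpole (p * a) (mul_ne_zero hp0 ha)).tendsto_limUnder.comp
      (tendsto_const_mul_nhdsNE hp0)
    have hright := ((hφ a).continuousAt.tendsto.mono_left nhdsWithin_le_nhds).mul
      (hpole a ha).tendsto_limUnder
    exact tendsto_nhds_unique (hleft.congr' (hfe a ha)) hright

end Quasiperiodic

section Denominators

variable {p x : ℂ}

theorem exists_one_add_norm_pow_le (hp1 : ‖p‖ < 1) (x : ℂ) :
    ∃ C, ∀ n : ℕ, x * p ^ n ≠ 1 → 1 + ‖p‖ ^ n ≤ C * ‖1 - x * p ^ n‖ := by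
  have hp : Tendsto (fun n : ℕ => x * p ^ n) atTop (𝓝 0) := by
    simpa using (tendsto_pow_atTop_nhds_zero_of_norm_lt_one hp1).const_mul x
  have hpn : Tendsto (fun n : ℕ => ‖p‖ ^ n) atTop (𝓝 0) :=
    tendsto_pow_atTop_nhds_zero_of_lt_one (norm_nonneg p) hp1
  have hlim : Tendsto (fun n : ℕ => (1 + ‖p‖ ^ n) / ‖1 - x * p ^ n‖) atTop
      (𝓝 ((1 + 0) / ‖(1 : ℂ) - 0‖)) :=
    (hpn.const_add 1).div (hp.const_sub (1 : ℂ)).norm (by simp)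
  obtain ⟨C, hC⟩ := hlim.bddAbove_range
  refine ⟨C, fun n hn => ?_⟩
  rw [← div_le_iff₀ (norm_pos_iff.2 (sub_ne_zero.2 hn.symm))]
  exact hC ⟨n, rfl⟩

theorem exists_one_add_norm_zpow_le (hp0 : p ≠ 0) (hp1 : ‖p‖ < 1) (hx : x ≠ 0) :
    ∃ C > 0, ∀ e : ℤ, x * p ^ e ≠ 1 → 1 + ‖p‖ ^ e ≤ C * ‖1 - x * p ^ e‖ := by
  obtain ⟨C, hC⟩ := exists_one_add_norm_pow_le hp1 x
  obtain ⟨D, hD⟩ := exists_one_add_norm_pow_le hp1 x⁻¹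
  refine ⟨max 1 (max C (D / ‖x‖)), by positivity, fun e he => ?_⟩
  obtain ⟨n, rfl | rfl⟩ := e.eq_nat_or_neg
  · refine (hC n (by simpa using he)).trans ?_
    rw [zpow_natCast]
    gcongr
    simp
  · have hne : x⁻¹ * p ^ n ≠ 1 := by
      intro h
      rw [zpow_neg, zpow_natCast, ← inv_inv x, ← mul_inv, h, inv_one] at he
      exact he rfl
    have hflip : 1 - x⁻¹ * p ^ n = -(x⁻¹ * p ^ n) * (1 - x * p ^ (-n : ℤ)) := by
      rw [zpow_neg, zpow_natCast]
      field_simp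
      ring
    have h := hD n hne
    rw [hflip, norm_mul, norm_neg, norm_mul, norm_inv, norm_pow] at h
    calc 1 + ‖p‖ ^ (-n : ℤ) = (1 + ‖p‖ ^ n) / ‖p‖ ^ n := by
          rw [zpow_neg, zpow_natCast]
          field_simp
          ring
      _ ≤ D / ‖x‖ * ‖1 - x * p ^ (-n : ℤ)‖ := by
          rw [div_le_iff₀ (by positivity)]
          calc _ ≤ _ := h
            _ = _ := by ring
      _ ≤ _ := by
          gcongr
          simp

theorem exists_eventually_one_add_norm_zpow_le (hp0 : p ≠ 0) (hp1 : ‖p‖ < 1) (hx : x ≠ 0) :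
    ∃ C > 0, ∀ᶠ w in 𝓝 x, ∀ e : ℤ, x * p ^ e ≠ 1 → 1 + ‖p‖ ^ e ≤ C * ‖1 - w * p ^ e‖ := by
  obtain ⟨C, hC0, hC⟩ := exists_one_add_norm_zpow_le hp0 hp1 hx
  refine ⟨2 * C, by positivity, ?_⟩
  filter_upwards [Metric.ball_mem_nhds x (ε := 1 / (2 * C)) (by positivity)] with w hw e he
  rw [Metric.mem_ball, dist_eq_norm, lt_div_iff₀ (by positivity)] at hw
  have hpe : 0 ≤ ‖p‖ ^ e := by positivity
  have htri : ‖1 - x * p ^ e‖ ≤ ‖1 - w * p ^ e‖ + ‖w - x‖ * ‖p‖ ^ e := by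
    rw [← norm_zpow, ← norm_mul]
    refine le_of_eq_of_le (congrArg _ ?_) (norm_add_le _ _)
    ring
  nlinarith [hC e he, mul_le_mul_of_nonneg_left htri hC0.le, mul_le_mul_of_nonneg_right hw.le hpe]

theorem eventually_mul_zpow_ne_one (hp0 : p ≠ 0) (hp1 : ‖p‖ < 1) (hx : x ≠ 0) :
    ∀ᶠ w in 𝓝[≠] x, ∀ e : ℤ, w * p ^ e ≠ 1 := by
  obtain ⟨C, -, hC⟩ := exists_eventually_one_add_norm_zpow_le hp0 hp1 hx
  filter_upwards [hC.filter_mono nhdsWithin_le_nhds, self_mem_nhdsWithin] with w hw hwx e he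
  have hpe : p ^ e ≠ 0 := zpow_ne_zero e hp0
  by_cases hxe : x * p ^ e = 1
  · exact hwx (mul_right_cancel₀ hpe (he.trans hxe.symm))
  · have hle := hw e hxe
    rw [he, sub_self, norm_zero, mul_zero] at hle
    linarith [zpow_nonneg (norm_nonneg p) e]

end Denominators

section Pochhammer

variable {q : ℂ}

theorem summable_norm_neg_pow_mul (a : ℂ) (hq : ‖q‖ < 1) :
    Summable fun i : ℕ => ‖-(q ^ i * a)‖ := by
  simpa only [norm_neg, norm_mul, norm_pow] using
    (summable_geometric_of_lt_one (norm_nonneg q) hq).mul_right ‖a‖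

theorem qPoch_zero (q : ℂ) : qPoch 0 q = 1 := by simp [qPoch]

theorem qPoch_eq_one_sub_mul (a : ℂ) (hq : ‖q‖ < 1) :
    qPoch a q = (1 - a) * qPoch (q * a) q := by
  have h : ∀ i : ℕ, 1 - q ^ (i + 1) * a = 1 - q ^ i * (q * a) := fun i => by ring
  have hm : Multipliable fun i : ℕ => 1 - q ^ (i + 1) * a := by
    simpa only [h] using multipliable_qPoch (q * a) hq
  simpa only [qPoch, pow_zero, one_mul, h] using
    tprod_eq_zero_mul' (f := fun i : ℕ => 1 - q ^ i * a) hm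

theorem qPoch_ne_zero {a : ℂ} (hq : ‖q‖ < 1) (h : ∀ i : ℕ, q ^ i * a ≠ 1) : qPoch a q ≠ 0 := by
  have := tprod_one_add_ne_zero_of_summable (f := fun i : ℕ => -(q ^ i * a))
    (fun i => by simpa [← sub_eq_add_neg, sub_eq_zero] using (h i).symm)
    (summable_norm_neg_pow_mul a hq)
  simpa only [qPoch, sub_eq_add_neg] using this

theorem qPoch_zpow_ne_zero (hq : ‖q‖ < 1) {m : ℤ} (hm : 0 < m) : qPoch (q ^ m) q ≠ 0 := by
  refine qPoch_ne_zero hq fun i h => ?_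
  lift m to ℕ using hm.le
  have hlt : ‖q ^ i * q ^ (m : ℤ)‖ < 1 := by
    rw [zpow_natCast, ← pow_add, norm_pow]
    exact pow_lt_one₀ (norm_nonneg _) hq (by lia)
  rw [h, norm_one] at hlt
  exact hlt.false

theorem qPoch_self_ne_zero (hq : ‖q‖ < 1) : qPoch q q ≠ 0 := by
  simpa using qPoch_zpow_ne_zero hq one_pos

theorem differentiable_qPoch (hq : ‖q‖ < 1) : Differentiable ℂ fun a => qPoch a q := by
  intro a
  have hu : Summable fun i : ℕ => ‖q‖ ^ i * (‖a‖ + 1) :=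
    (summable_geometric_of_lt_one (norm_nonneg q) hq).mul_right _
  have hprod := Summable.hasProdLocallyUniformlyOn_nat_one_add
    (f := fun (i : ℕ) (x : ℂ) => -(q ^ i * x)) (Metric.isOpen_ball (x := a) (ε := 1)) hu
    (Eventually.of_forall fun n x hx => by
      rw [norm_neg, norm_mul, norm_pow]
      gcongr
      rw [Metric.mem_ball, dist_eq_norm] at hx
      linarith [norm_sub_norm_le x a]) (fun n => by fun_prop)
  have hdiff := hprod.differentiableOn (.of_forall fun _ => by
    simpa [Finset.prod_fn] using DifferentiableOn.finsetProd (fun _ _ => by fun_prop))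
    Metric.isOpen_ball
  simpa only [qPoch, sub_eq_add_neg] using hdiff.differentiableAt (Metric.ball_mem_nhds a one_pos)

theorem analyticAt_qPoch_comp {f : ℂ → ℂ} {x : ℂ} (hq : ‖q‖ < 1) (hf : AnalyticAt ℂ f x) :
    AnalyticAt ℂ (fun x => qPoch (f x) q) x :=
  ((differentiable_qPoch hq).analyticAt (f x)).comp hf

theorem norm_sq_lt_one (hq : ‖q‖ < 1) : ‖q ^ 2‖ < 1 := by
  rw [norm_pow]
  exact pow_lt_one₀ (norm_nonneg _) hq two_ne_zero

theorem qPoch_eq_mul_sq (a : ℂ) (hq : ‖q‖ < 1) :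
    qPoch a q = qPoch a (q ^ 2) * qPoch (q * a) (q ^ 2) := by
  have heven : ∀ i : ℕ, 1 - q ^ (2 * i) * a = 1 - (q ^ 2) ^ i * a := fun i => by rw [pow_mul]
  have hodd : ∀ i : ℕ, 1 - q ^ (2 * i + 1) * a = 1 - (q ^ 2) ^ i * (q * a) := fun i => by
    rw [pow_add, pow_mul]
    ring
  have h := tprod_even_mul_odd (f := fun i : ℕ => 1 - q ^ i * a)
    (by simpa only [heven] using multipliable_qPoch a (norm_sq_lt_one hq))
    (by simpa only [hodd] using multipliable_qPoch (q * a) (norm_sq_lt_one hq))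
  simp only [heven, hodd] at h
  exact h.symm

theorem qPoch_mul_qPoch_neg (a : ℂ) (hq : ‖q‖ < 1) :
    qPoch a q * qPoch (-a) q = qPoch (a ^ 2) (q ^ 2) := by
  rw [qPoch, qPoch, ← (multipliable_qPoch a hq).tprod_mul (multipliable_qPoch (-a) hq), qPoch]
  exact tprod_congr fun i => by ring

end Pochhammer

section Theta

/-- The theta product `(x, p / x; p)_∞`. For `x = 0` the junk value `p / 0 = 0` makes it `1`. -/
def theta (x p : ℂ) : ℂ := qPoch x p * qPoch (p / x) p

variable {p q x : ℂ}

theorem theta_div (x : ℂ) (hp0 : p ≠ 0) : theta (p / x) p = theta x p := by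
  rw [theta, theta, div_div_cancel₀ hp0, mul_comm]

theorem theta_eq_one_sub_mul (hp1 : ‖p‖ < 1) (x : ℂ) :
    theta x p = (1 - x) * (qPoch (p * x) p * qPoch (p / x) p) := by
  rw [theta, qPoch_eq_one_sub_mul x hp1, mul_assoc]

theorem theta_one (hp1 : ‖p‖ < 1) : theta 1 p = 0 := by
  rw [theta_eq_one_sub_mul hp1, sub_self, zero_mul]

theorem theta_mul (hp0 : p ≠ 0) (hp1 : ‖p‖ < 1) (hx : x ≠ 0) :
    theta (p * x) p = -x⁻¹ * theta x p := by
  have hdiv : p / (p * x) = x⁻¹ := by field_simp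
  rw [theta, hdiv, qPoch_eq_one_sub_mul x⁻¹ hp1, theta_eq_one_sub_mul hp1, ← div_eq_mul_inv]
  field_simp
  ring

theorem theta_inv (hp0 : p ≠ 0) (hp1 : ‖p‖ < 1) (hx : x ≠ 0) :
    theta x⁻¹ p = -x⁻¹ * theta x p := by
  rw [← theta_mul hp0 hp1 hx, ← theta_div (p * x) hp0, div_mul_cancel_left₀ hp0]

theorem theta_eq_zero_iff (hp0 : p ≠ 0) (hp1 : ‖p‖ < 1) :
    theta x p = 0 ↔ ∃ n : ℤ, x = p ^ n := by
  constructor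
  · intro h
    contrapose! h
    refine mul_ne_zero (qPoch_ne_zero hp1 fun i hi => ?_) (qPoch_ne_zero hp1 fun i hi => ?_)
    · apply h (-(i : ℤ))
      rw [zpow_neg, zpow_natCast]
      exact eq_inv_of_mul_eq_one_right hi
    · apply h ((i : ℤ) + 1)
      rcases eq_or_ne x 0 with rfl | hx0
      · simp at hi
      · rw [← Nat.cast_succ, zpow_natCast, pow_succ]
        rw [← mul_div_assoc, div_eq_one_iff_eq hx0] at hi
        exact hi.symm
  · rintro ⟨n, rfl⟩
    have h := zpow_mul_iff_of_mul_iff (P := fun a => theta a p = 0) hp0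
      (fun a ha => by simp [theta_mul hp0 hp1 ha, ha]) one_ne_zero n
    simpa only [mul_one] using h.2 (theta_one hp1)

theorem theta_ne_zero_iff (hp0 : p ≠ 0) (hp1 : ‖p‖ < 1) :
    theta x p ≠ 0 ↔ ∀ e : ℤ, x * p ^ e ≠ 1 := by
  rw [← not_iff_not, not_not, theta_eq_zero_iff hp0 hp1]
  push Not
  refine ⟨fun ⟨n, hn⟩ => ⟨-n, ?_⟩, fun ⟨e, he⟩ => ⟨-e, ?_⟩⟩
  · rw [hn, ← zpow_add₀ hp0, add_neg_cancel, zpow_zero]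
  · rw [zpow_neg]
    exact eq_inv_of_mul_eq_one_left he

theorem theta_ne_zero_of_norm_lt (hp0 : p ≠ 0) (hpx : ‖p‖ < ‖x‖) (hx1 : ‖x‖ < 1) :
    theta x p ≠ 0 := by
  have hpn : 0 < ‖p‖ := norm_pos_iff.2 hp0
  have hp1 : ‖p‖ < 1 := hpx.trans hx1
  rw [Ne, theta_eq_zero_iff hp0 hp1]
  rintro ⟨n, rfl⟩
  rw [norm_zpow] at hpx hx1
  rw [← zpow_zero ‖p‖, zpow_lt_zpow_iff_right_of_lt_one₀ hpn hp1] at hx1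
  nth_rewrite 1 [← zpow_one ‖p‖] at hpx
  rw [zpow_lt_zpow_iff_right_of_lt_one₀ hpn hp1] at hpx
  lia

theorem theta_neg_one_ne_zero (hp0 : p ≠ 0) (hp1 : ‖p‖ < 1) : theta (-1) p ≠ 0 := by
  rw [Ne, theta_eq_zero_iff hp0 hp1]
  rintro ⟨n, hn⟩
  have hnorm := congrArg norm hn
  rw [norm_neg, norm_one, norm_zpow, eq_comm,
    zpow_eq_one_iff_right₀ (norm_nonneg p) hp1.ne] at hnorm
  norm_num [hnorm] at hn

theorem eventually_theta_ne_zero (hp0 : p ≠ 0) (hp1 : ‖p‖ < 1) (hx : x ≠ 0) :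
    ∀ᶠ w in 𝓝[≠] x, theta w p ≠ 0 := by
  simpa only [theta_ne_zero_iff hp0 hp1] using eventually_mul_zpow_ne_one hp0 hp1 hx

theorem analyticAt_theta_comp {f : ℂ → ℂ} (hp1 : ‖p‖ < 1) (hf : AnalyticAt ℂ f x)
    (hfx : f x ≠ 0) : AnalyticAt ℂ (fun x => theta (f x) p) x :=
  (analyticAt_qPoch_comp hp1 hf).mul (analyticAt_qPoch_comp hp1 (analyticAt_const.div hf hfx))

theorem hasSimplePoleAt_inv_theta (hp1 : ‖p‖ < 1) :
    HasSimplePoleAt (fun x => (theta x p)⁻¹) (-(qPoch p p ^ 2)⁻¹) 1 := by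
  refine ⟨fun x => -(qPoch (p * x) p * qPoch (p / x) p)⁻¹, ?_, by simp [sq],
    Eventually.of_forall fun x => ?_⟩
  · refine (AnalyticAt.inv ((analyticAt_qPoch_comp hp1 (by fun_prop)).mul
      (analyticAt_qPoch_comp hp1 ?_)) ?_).neg
    · exact analyticAt_const.div analyticAt_id one_ne_zero
    · simpa using qPoch_self_ne_zero hp1
  · beta_reduce
    rw [theta_eq_one_sub_mul hp1, mul_inv, ← neg_sub x 1, inv_neg, div_eq_mul_inv]
    ring

theorem theta_sq (x : ℂ) (hq0 : q ≠ 0) (hq1 : ‖q‖ < 1) :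
    theta x q = theta x (q ^ 2) * theta (q * x) (q ^ 2) := by
  have hdiv : q ^ 2 / (q * x) = q / x := by
    rw [sq, mul_div_mul_left _ _ hq0]
  have hmul : q * (q / x) = q ^ 2 / x := by ring
  rw [theta, theta, theta, qPoch_eq_mul_sq x hq1, qPoch_eq_mul_sq (q / x) hq1, hdiv, hmul]
  ring

theorem theta_neg_one_mul_sq (hq : ‖q‖ < 1) :
    theta (-1) q * qPoch q q ^ 2 = 2 * qPoch (q ^ 2) (q ^ 2) ^ 2 := by
  rw [theta_eq_one_sub_mul hq, ← qPoch_mul_qPoch_neg q hq]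
  simp only [mul_neg, mul_one, div_neg, div_one]
  ring

end Theta

section ThetaSeries

variable {q u : ℂ}

/-- The summand `(-1) ^ k q ^ (k²) u ^ k` of the theta series. -/
def thetaTerm (q u : ℂ) (k : ℤ) : ℂ := (-1) ^ k * q ^ (k ^ 2) * u ^ k

/-- The theta series `∑_k (-1) ^ k q ^ (k²) u ^ k`. -/
def thetaSum (q u : ℂ) : ℂ := ∑' k : ℤ, thetaTerm q u k

theorem summable_zpow_sq_mul_pow_natAbs {Q M : ℝ} (hQ0 : 0 < Q) (hQ1 : Q < 1) (hM : 0 ≤ M) :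
    Summable fun k : ℤ => Q ^ (k ^ 2) * M ^ k.natAbs := by
  have hN : Summable fun n : ℕ => Q ^ ((n : ℤ) ^ 2) * M ^ n := by
    have hlim : Tendsto (fun n : ℕ => Q ^ n * M) atTop (𝓝 0) := by
      simpa using (tendsto_pow_atTop_nhds_zero_of_lt_one hQ0.le hQ1).mul_const M
    have hhalf : ∀ᶠ n : ℕ in atTop, Q ^ n * M < 1 / 2 := hlim.eventually_lt_const (by norm_num)
    refine Summable.of_norm_bounded_eventually_nat (g := fun n : ℕ => (1 / 2 : ℝ) ^ n)
      (summable_geometric_of_lt_one (by norm_num) (by norm_num)) ?_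
    filter_upwards [hhalf] with n hn
    have hpow : Q ^ ((n : ℤ) ^ 2) * M ^ n = (Q ^ n * M) ^ n := by
      rw [mul_pow, ← pow_mul, ← sq]
      norm_cast
    rw [hpow, Real.norm_of_nonneg (by positivity)]
    exact pow_le_pow_left₀ (by positivity) hn.le n
  exact Summable.of_nat_of_neg (by simpa using hN) (by simpa using hN)

theorem norm_zpow_le_pow_natAbs {M : ℝ} (hu : ‖u‖ ≤ M) (hu' : ‖u‖⁻¹ ≤ M) (k : ℤ) :
    ‖u ^ k‖ ≤ M ^ k.natAbs := by
  rw [norm_zpow]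
  obtain ⟨n, rfl | rfl⟩ := k.eq_nat_or_neg
  · simpa using pow_le_pow_left₀ (norm_nonneg _) hu n
  · simpa using pow_le_pow_left₀ (inv_nonneg.2 (norm_nonneg _)) hu' n

theorem norm_thetaTerm_le {M : ℝ} (hu : ‖u‖ ≤ M) (hu' : ‖u‖⁻¹ ≤ M) (k : ℤ) :
    ‖thetaTerm q u k‖ ≤ ‖q‖ ^ (k ^ 2) * M ^ k.natAbs := by
  rw [thetaTerm, norm_mul, norm_mul, norm_zpow, norm_zpow, norm_neg, norm_one, one_zpow, one_mul]
  gcongr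
  exact norm_zpow_le_pow_natAbs hu hu' k

theorem summable_norm_thetaTerm (hq0 : q ≠ 0) (hq1 : ‖q‖ < 1) (u : ℂ) :
    Summable fun k : ℤ => ‖thetaTerm q u k‖ :=
  Summable.of_nonneg_of_le (fun _ => norm_nonneg _)
    (norm_thetaTerm_le (le_max_left ‖u‖ ‖u‖⁻¹) (le_max_right _ _))
    (summable_zpow_sq_mul_pow_natAbs (norm_pos_iff.2 hq0) hq1
      (le_max_of_le_left (norm_nonneg _)))

theorem thetaTerm_add_one (hq0 : q ≠ 0) (hu : u ≠ 0) (k : ℤ) :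
    thetaTerm q u (k + 1) = -(q * u) * (q ^ 2) ^ k * thetaTerm q u k := by
  have hsq : q ^ ((k + 1) ^ 2) = q ^ (k ^ 2) * (q ^ 2) ^ k * q := by
    rw [← zpow_natCast q 2, ← zpow_mul, ← zpow_add₀ hq0, ← zpow_add_one₀ hq0]
    congr 1
    push_cast
    ring
  rw [thetaTerm, thetaTerm, hsq, zpow_add_one₀ hu, zpow_add_one₀ (by norm_num)]
  ring

end ThetaSeries

section TripleProduct

variable {p : ℂ}

theorem qPoch_zpow_add_one (hp0 : p ≠ 0) (hp1 : ‖p‖ < 1) (m : ℤ) :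
    qPoch (p ^ m) p = (1 - p ^ m) * qPoch (p ^ (m + 1)) p := by
  rw [qPoch_eq_one_sub_mul _ hp1, zpow_add_one₀ hp0, mul_comm p]

theorem qPoch_zpow_eq_zero (hp0 : p ≠ 0) (hp1 : ‖p‖ < 1) {m : ℤ} (hm : m ≤ 0) :
    qPoch (p ^ m) p = 0 := by
  induction m, hm using Int.leInductionDown with
  | base => rw [qPoch_zpow_add_one hp0 hp1, zpow_zero, sub_self, zero_mul]
  | pred m _ ih => rw [qPoch_zpow_add_one hp0 hp1, sub_add_cancel, ih, mul_zero]

theorem tendsto_qPoch_zpow (hp1 : ‖p‖ < 1) :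
    Tendsto (fun m : ℤ => qPoch (p ^ m) p) atTop (𝓝 1) := by
  have hpow : Tendsto (fun m : ℤ => p ^ m) atTop (𝓝 0) := by
    rw [← Nat.map_cast_int_atTop, tendsto_map'_iff]
    simpa [Function.comp_def] using tendsto_pow_atTop_nhds_zero_of_norm_lt_one hp1
  rw [← qPoch_zero p]
  exact ((differentiable_qPoch hp1).continuous.tendsto 0).comp hpow

theorem exists_norm_qPoch_zpow_le (hp0 : p ≠ 0) (hp1 : ‖p‖ < 1) :
    ∃ C, ∀ m : ℤ, ‖qPoch (p ^ m) p‖ ≤ C := by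
  obtain ⟨C, hC⟩ := (isCompact_closedBall (0 : ℂ) 1).exists_bound_of_continuousOn
    (differentiable_qPoch hp1).continuous.continuousOn
  refine ⟨C, fun m => ?_⟩
  rcases le_total m 0 with hm | hm
  · rw [qPoch_zpow_eq_zero hp0 hp1 hm, norm_zero]
    exact (norm_nonneg _).trans (hC 0 (by simp))
  · refine hC _ ?_
    lift m to ℕ using hm
    rw [mem_closedBall_zero_iff, zpow_natCast, norm_pow]
    exact pow_le_one₀ (norm_nonneg _) hp1.le

/-- The Gaussian binomial coefficient `[a + b, a]_p`, written with infinite products so that it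
vanishes for `a < 0` or `b < 0` and Pascal's rule holds for all integers with `0 < a + b`. -/
def gaussBinom (p : ℂ) (a b : ℤ) : ℂ :=
  qPoch (p ^ (a + 1)) p * qPoch (p ^ (b + 1)) p / (qPoch (p ^ (a + b + 1)) p * qPoch p p)

theorem gaussBinom_comm (p : ℂ) (a b : ℤ) : gaussBinom p a b = gaussBinom p b a := by
  rw [gaussBinom, gaussBinom, add_comm a b, mul_comm (qPoch (p ^ (a + 1)) p)]

theorem gaussBinom_pascal (hp0 : p ≠ 0) (hp1 : ‖p‖ < 1) {a b : ℤ} (hab : 0 < a + b) :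
    gaussBinom p a b = gaussBinom p (a - 1) b + p ^ a * gaussBinom p a (b - 1) := by
  have hsum : qPoch (p ^ (a + b)) p ≠ 0 := qPoch_zpow_ne_zero hp1 hab
  have hself := qPoch_self_ne_zero hp1
  rw [gaussBinom, gaussBinom, gaussBinom, sub_add_cancel, sub_add_cancel,
    show a - 1 + b + 1 = a + b by ring, show a + (b - 1) + 1 = a + b by ring]
  rw [qPoch_zpow_add_one hp0 hp1 (a + b)] at hsum ⊢
  obtain ⟨hfactor, hrest⟩ := mul_ne_zero_iff.1 hsum
  rw [qPoch_zpow_add_one hp0 hp1 a, qPoch_zpow_add_one hp0 hp1 b]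
  field_simp
  rw [zpow_add₀ hp0 a b]
  ring

theorem gaussBinom_add_one_add_one (hp0 : p ≠ 0) (hp1 : ‖p‖ < 1) {a b : ℤ} (hab : 0 ≤ a + b) :
    gaussBinom p (a + 1) (b + 1) = (1 + p ^ (a + b + 1)) * gaussBinom p a b
      + p ^ (a + 1) * gaussBinom p (a + 1) (b - 1)
      + p ^ (b + 1) * gaussBinom p (a - 1) (b + 1) := by
  have h₁ : gaussBinom p (a + 1) (b + 1) =
      gaussBinom p a (b + 1) + p ^ (a + 1) * gaussBinom p (a + 1) b := by
    simpa using gaussBinom_pascal hp0 hp1 (a := a + 1) (b := b + 1) (by lia)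
  have h₂ : gaussBinom p (b + 1) a =
      gaussBinom p b a + p ^ (b + 1) * gaussBinom p (b + 1) (a - 1) := by
    simpa using gaussBinom_pascal hp0 hp1 (a := b + 1) (b := a) (by lia)
  have h₃ : gaussBinom p b (a + 1) =
      gaussBinom p (b - 1) (a + 1) + p ^ b * gaussBinom p b a := by
    simpa using gaussBinom_pascal hp0 hp1 (a := b) (b := a + 1) (by lia)
  rw [h₁, gaussBinom_comm p a (b + 1), h₂, gaussBinom_comm p (a + 1) b, h₃,
    gaussBinom_comm p b a, gaussBinom_comm p (b - 1), gaussBinom_comm p (b + 1),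
    show a + b + 1 = (a + 1) + b by ring, zpow_add₀ hp0 (a + 1) b]
  ring

theorem gaussBinom_neg_self (hp0 : p ≠ 0) (hp1 : ‖p‖ < 1) (k : ℤ) :
    gaussBinom p (-k) k = if k = 0 then 1 else 0 := by
  split_ifs with hk
  · simp [gaussBinom, hk, qPoch_self_ne_zero hp1]
  · rcases lt_or_gt_of_ne hk with h | h
    · rw [gaussBinom, qPoch_zpow_eq_zero hp0 hp1 (m := k + 1) (by lia), mul_zero, zero_div]
    · rw [gaussBinom, qPoch_zpow_eq_zero hp0 hp1 (m := -k + 1) (by lia), zero_mul, zero_div]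

theorem tendsto_gaussBinom (hp1 : ‖p‖ < 1) {ι : Type*} {l : Filter ι} {a b : ι → ℤ}
    (ha : Tendsto a l atTop) (hb : Tendsto b l atTop) :
    Tendsto (fun i => gaussBinom p (a i) (b i)) l (𝓝 (qPoch p p)⁻¹) := by
  have hG {c : ι → ℤ} (hc : Tendsto c l atTop) :
      Tendsto (fun i => qPoch (p ^ (c i + 1)) p) l (𝓝 1) :=
    (tendsto_qPoch_zpow hp1).comp (tendsto_atTop_add_const_right _ 1 hc)
  have h := ((hG ha).mul (hG hb)).div ((hG (ha.atTop_add_atTop hb)).mul_const (qPoch p p))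
    (by simpa using qPoch_self_ne_zero hp1)
  rwa [one_mul, one_mul, one_div] at h

theorem exists_norm_gaussBinom_le (hp0 : p ≠ 0) (hp1 : ‖p‖ < 1) :
    ∃ C, ∀ a b, 0 ≤ a + b → ‖gaussBinom p a b‖ ≤ C := by
  obtain ⟨C, hC⟩ := exists_norm_qPoch_zpow_le hp0 hp1
  have hC0 : 0 ≤ C := (norm_nonneg _).trans (hC 0)
  have hden : Tendsto (fun n : ℕ => (qPoch (p ^ ((n : ℤ) + 1)) p * qPoch p p)⁻¹) atTop
      (𝓝 (1 * qPoch p p)⁻¹) :=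
    (((tendsto_qPoch_zpow hp1).comp (tendsto_atTop_add_const_right _ 1
      tendsto_natCast_atTop_atTop)).mul_const _).inv₀ (by simpa using qPoch_self_ne_zero hp1)
  obtain ⟨D, hD⟩ := (Metric.isBounded_range_of_tendsto _ hden).exists_norm_le
  refine ⟨C * C * D, fun a b hab => ?_⟩
  obtain ⟨n, hn⟩ := Int.eq_ofNat_of_zero_le hab
  rw [gaussBinom, div_eq_mul_inv, norm_mul, norm_mul, hn]
  gcongr
  · exact hC _
  · exact hC _
  · exact hD _ ⟨n, rfl⟩

variable {q u : ℂ}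

theorem thetaTerm_add_one_mul (hq0 : q ≠ 0) (hu : u ≠ 0) (n : ℕ) (k : ℤ) :
    thetaTerm q u (k + 1) * ((q ^ 2) ^ n * (q / u)) =
      -(q ^ 2) ^ ((n : ℤ) + k + 1) * thetaTerm q u k := by
  have hp0 := pow_ne_zero 2 hq0
  rw [thetaTerm_add_one hq0 hu, zpow_add_one₀ hp0, zpow_add₀ hp0, zpow_natCast]
  field_simp

theorem thetaTerm_sub_one_mul (hq0 : q ≠ 0) (hu : u ≠ 0) (n : ℕ) (k : ℤ) :
    thetaTerm q u (k - 1) * ((q ^ 2) ^ n * (q * u)) =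
      -(q ^ 2) ^ ((n : ℤ) - k + 1) * thetaTerm q u k := by
  have hp0 := pow_ne_zero 2 hq0
  have h := thetaTerm_add_one hq0 hu (k - 1)
  rw [sub_add_cancel] at h
  rw [h, zpow_sub_one₀ hp0, zpow_add_one₀ hp0, zpow_sub₀ hp0, zpow_natCast]
  field_simp

theorem hasSum_thetaTerm_mul_gaussBinom (hq0 : q ≠ 0) (hq1 : ‖q‖ < 1) (hu : u ≠ 0) (n : ℕ) :
    HasSum (fun k : ℤ => thetaTerm q u k * gaussBinom (q ^ 2) (n - k) (n + k))
      (∏ i ∈ Finset.range n, (1 - (q ^ 2) ^ i * (q * u)) * (1 - (q ^ 2) ^ i * (q / u))) := by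
  have hp0 : q ^ 2 ≠ 0 := pow_ne_zero _ hq0
  have hp1 : ‖q ^ 2‖ < 1 := norm_sq_lt_one hq1
  induction n with
  | zero =>
    simp only [Nat.cast_zero, zero_sub, zero_add, gaussBinom_neg_self hp0 hp1, Finset.range_zero,
      Finset.prod_empty]
    convert hasSum_ite_eq (0 : ℤ) (1 : ℂ) using 2 with k
    split_ifs with hk <;> simp [hk, thetaTerm]
  | succ n ih =>
    have hsucc := (Equiv.addRight (1 : ℤ)).hasSum_iff.2 ih
    have hpred := (Equiv.subRight (1 : ℤ)).hasSum_iff.2 ih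
    have hsum := ((ih.mul_left (1 + (q ^ 2) ^ (2 * n + 1))).sub
      (hpred.mul_left ((q ^ 2) ^ n * (q * u)))).sub (hsucc.mul_left ((q ^ 2) ^ n * (q / u)))
    have hfactor : (1 - (q ^ 2) ^ n * (q * u)) * (1 - (q ^ 2) ^ n * (q / u)) =
        1 + (q ^ 2) ^ (2 * n + 1) - (q ^ 2) ^ n * (q * u) - (q ^ 2) ^ n * (q / u) := by
      field_simp
      ring
    rw [← sub_mul, ← sub_mul, ← hfactor, mul_comm (_ * _) (Finset.prod _ _),
      ← Finset.prod_range_succ] at hsum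
    refine hsum.congr_fun fun k => ?_
    have hrec := gaussBinom_add_one_add_one hp0 hp1 (a := n - k) (b := n + k) (by lia)
    rw [show (n - k + (n + k) + 1 : ℤ) = (2 * n + 1 : ℕ) by push_cast; ring, zpow_natCast] at hrec
    simp only [Function.comp_apply, Equiv.coe_addRight, Equiv.subRight_apply]
    rw [show ((n + 1 : ℕ) - k : ℤ) = n - k + 1 by push_cast; ring,
      show ((n + 1 : ℕ) + k : ℤ) = n + k + 1 by push_cast; ring, hrec,
      show (n - (k - 1) : ℤ) = n - k + 1 by ring, show (n + (k - 1) : ℤ) = n + k - 1 by ring,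
      show (n - (k + 1) : ℤ) = n - k - 1 by ring, show (n + (k + 1) : ℤ) = n + k + 1 by ring]
    linear_combination gaussBinom (q ^ 2) (n - k - 1) (n + k + 1) * thetaTerm_add_one_mul hq0 hu n k
      + gaussBinom (q ^ 2) (n - k + 1) (n + k - 1) * thetaTerm_sub_one_mul hq0 hu n k

/-- Jacobi's triple product identity. -/
theorem thetaSum_eq_qPoch_mul_theta (hq0 : q ≠ 0) (hq1 : ‖q‖ < 1) (hu : u ≠ 0) :
    thetaSum q u = qPoch (q ^ 2) (q ^ 2) * theta (q * u) (q ^ 2) := by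
  have hp1 : ‖q ^ 2‖ < 1 := norm_sq_lt_one hq1
  obtain ⟨C, hC⟩ := exists_norm_gaussBinom_le (pow_ne_zero 2 hq0) hp1
  have hsum : Tendsto (fun n : ℕ => ∑' k, thetaTerm q u k * gaussBinom (q ^ 2) (n - k) (n + k))
      atTop (𝓝 (∑' k, thetaTerm q u k * (qPoch (q ^ 2) (q ^ 2))⁻¹)) := by
    refine tendsto_tsum_of_dominated_convergence ((summable_norm_thetaTerm hq0 hq1 u).mul_right C)
      (fun k => (tendsto_gaussBinom hp1 ?_ ?_).const_mul _) (Eventually.of_forall fun n k => ?_)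
    · exact tendsto_atTop_add_const_right _ (-k) tendsto_natCast_atTop_atTop
    · exact tendsto_atTop_add_const_right _ k tendsto_natCast_atTop_atTop
    · rw [norm_mul]
      gcongr
      exact hC _ _ (by lia)
  have hprod : Tendsto (fun n : ℕ => ∏ i ∈ Finset.range n, (1 - (q ^ 2) ^ i * (q * u)) *
      (1 - (q ^ 2) ^ i * (q / u))) atTop (𝓝 (theta (q * u) (q ^ 2))) := by
    rw [theta, show q ^ 2 / (q * u) = q / u by rw [sq, mul_div_mul_left _ _ hq0]]
    simp only [Finset.prod_mul_distrib]
    exact (multipliable_qPoch _ hp1).hasProd.tendsto_prod_nat.mul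
      (multipliable_qPoch _ hp1).hasProd.tendsto_prod_nat
  have heq := tendsto_nhds_unique hprod (hsum.congr fun n =>
    (hasSum_thetaTerm_mul_gaussBinom hq0 hq1 hu n).tsum_eq)
  rw [heq, tsum_mul_right, mul_comm, ← thetaSum, inv_mul_cancel_right₀ (qPoch_self_ne_zero hp1)]

end TripleProduct

section PartialFractions

variable {p x : ℂ} {ι : Type*} {a : ι → ℂ} {e : ι → ℤ}

theorem norm_div_le_of_le_mul_norm {C r : ℝ} {b z : ℂ} (hr : 0 < r) (h : r ≤ C * ‖z‖) :
    ‖b / z‖ ≤ C * (‖b‖ / r) := by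
  have hz : 0 < ‖z‖ := (norm_nonneg z).lt_of_ne fun h0 => by
    rw [← h0, mul_zero] at h
    exact hr.not_ge h
  rw [norm_div, mul_div_assoc', div_le_div_iff₀ hz hr]
  calc ‖b‖ * r ≤ ‖b‖ * (C * ‖z‖) := by gcongr
    _ = C * ‖b‖ * ‖z‖ := by ring

theorem summable_norm_div_one_add_zpow (p : ℂ) (e : ι → ℤ) (ha : Summable fun i => ‖a i‖) :
    Summable fun i => ‖a i‖ / (1 + ‖p‖ ^ e i) :=
  ha.of_nonneg_of_le (fun _ => by positivity)
    fun _ => div_le_self (norm_nonneg _) (le_add_of_nonneg_right (by positivity))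

theorem summable_norm_div_one_sub_mul_zpow (hp0 : p ≠ 0) (hp1 : ‖p‖ < 1)
    (ha : Summable fun i => ‖a i‖ / (1 + ‖p‖ ^ e i)) (hx : x ≠ 0) :
    Summable fun i => ‖a i / (1 - x * p ^ e i)‖ := by
  obtain ⟨C, hC0, hC⟩ := exists_one_add_norm_zpow_le hp0 hp1 hx
  refine Summable.of_nonneg_of_le (fun _ => norm_nonneg _) (fun i => ?_) (ha.mul_left C)
  by_cases hi : x * p ^ e i = 1
  · rw [hi, sub_self, div_zero, norm_zero]
    positivity
  · exact norm_div_le_of_le_mul_norm (by positivity) (hC _ hi)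

theorem analyticAt_tsum_div_one_sub_mul_zpow (hp0 : p ≠ 0) (hp1 : ‖p‖ < 1)
    (ha : Summable fun i => ‖a i‖ / (1 + ‖p‖ ^ e i)) (hx : x ≠ 0)
    (h : ∀ i, a i ≠ 0 → x * p ^ e i ≠ 1) :
    AnalyticAt ℂ (fun w => ∑' i, a i / (1 - w * p ^ e i)) x := by
  obtain ⟨C, -, hC⟩ := exists_eventually_one_add_norm_zpow_le hp0 hp1 hx
  obtain ⟨r, hr, hball⟩ := Metric.eventually_nhds_iff_ball.1 hC
  refine (Complex.differentiableOn_tsum_of_summable_norm (ha.mul_left C) (fun i => ?_)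
    Metric.isOpen_ball (fun i w hw => ?_)).analyticAt (Metric.ball_mem_nhds x hr) <;>
    by_cases hi : a i = 0
  · simp only [hi, zero_div]
    exact differentiableOn_const _
  · intro w hw
    have hne : 1 - w * p ^ e i ≠ 0 := fun h0 => by
      have hle := hball w hw _ (h i hi)
      rw [h0, norm_zero, mul_zero] at hle
      exact hle.not_gt (by positivity)
    have hden : DifferentiableAt ℂ (fun w => 1 - w * p ^ e i) w := by fun_prop
    exact ((differentiableAt_const (a i)).fun_div hden hne).differentiableWithinAt
  · rw [hi, zero_div, norm_zero, zero_div, mul_zero]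
  · exact norm_div_le_of_le_mul_norm (by positivity) (hball w hw _ (h i hi))

theorem hasSimplePoleAt_div_one_sub_mul {b c : ℂ} (h : x * c = 1) :
    HasSimplePoleAt (fun w => b / (1 - w * c)) (-x * b) x := by
  refine ⟨fun _ => -x * b, analyticAt_const, rfl, ?_⟩
  have hx : x ≠ 0 := left_ne_zero_of_mul_eq_one h
  filter_upwards [self_mem_nhdsWithin] with w hw
  have hw' : x - w ≠ 0 := sub_ne_zero.2 (Ne.symm hw)
  rw [eq_inv_of_mul_eq_one_right h, show 1 - w * x⁻¹ = (x - w) / x by field_simp,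
    ← neg_sub x w]
  field_simp

theorem hasSimplePoleAt_tsum_div_one_sub_mul_zpow (hp0 : p ≠ 0) (hp1 : ‖p‖ < 1)
    (ha : Summable fun i => ‖a i‖ / (1 + ‖p‖ ^ e i)) {i₀ : ι} (h₀ : x * p ^ e i₀ = 1)
    (h : ∀ i, x * p ^ e i = 1 → i = i₀) :
    HasSimplePoleAt (fun w => ∑' i, a i / (1 - w * p ^ e i)) (-x * a i₀) x := by
  classical
  have hx : x ≠ 0 := left_ne_zero_of_mul_eq_one h₀
  have hrest := analyticAt_tsum_div_one_sub_mul_zpow (a := fun i => if i = i₀ then 0 else a i)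
    hp0 hp1 (ha.of_nonneg_of_le (fun i => by positivity) fun i => by
      gcongr
      split_ifs <;> simp) hx fun i hi hxi => hi (if_pos (h i hxi))
  have hpole := (hasSimplePoleAt_div_one_sub_mul (b := a i₀) h₀).add
    (hasSimplePoleAt_of_analyticAt hrest)
  rw [add_zero] at hpole
  refine hpole.congr ?_
  filter_upwards [(isOpen_ne.eventually_mem hx).filter_mono nhdsWithin_le_nhds] with w hw
  rw [(summable_norm_div_one_sub_mul_zpow hp0 hp1 ha hw).of_norm.tsum_eq_add_tsum_ite i₀]
  congr 1
  exact tsum_congr fun i => by rw [ite_div, zero_div]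

end PartialFractions

section KroneckerSum

/-- Kronecker's series `∑_n y ^ n / (1 - x q ^ n)`. -/
def kroneckerSum (q y x : ℂ) : ℂ := ∑' n : ℤ, y ^ n / (1 - x * q ^ n)

variable {q y x : ℂ}

theorem summable_norm_zpow_div_one_add (hq0 : q ≠ 0) (hqy : ‖q‖ < ‖y‖) (hy : ‖y‖ < 1) :
    Summable fun n : ℤ => ‖y ^ n‖ / (1 + ‖q‖ ^ n) := by
  have hqn : 0 < ‖q‖ := norm_pos_iff.2 hq0
  have hyn : 0 < ‖y‖ := hqn.trans hqy
  refine Summable.of_nat_of_neg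
    ((summable_geometric_of_lt_one hyn.le hy).of_nonneg_of_le (fun n => by positivity) fun n => ?_)
    ((summable_geometric_of_lt_one (r := ‖q‖ / ‖y‖) (by positivity)
      ((div_lt_one hyn).2 hqy)).of_nonneg_of_le (fun n => by positivity) fun n => ?_)
  · rw [zpow_natCast, norm_pow]
    exact div_le_self (by positivity) (le_add_of_nonneg_right (by positivity))
  · rw [norm_zpow, zpow_neg, zpow_neg, zpow_natCast, zpow_natCast, div_pow]
    calc (‖y‖ ^ n)⁻¹ / (1 + (‖q‖ ^ n)⁻¹) ≤ (‖y‖ ^ n)⁻¹ / (‖q‖ ^ n)⁻¹ := by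
          gcongr
          exact le_add_of_nonneg_left zero_le_one
      _ = ‖q‖ ^ n / ‖y‖ ^ n := by rw [div_inv_eq_mul, mul_comm, div_eq_mul_inv]

theorem kroneckerSum_mul (hq0 : q ≠ 0) (hy0 : y ≠ 0) (x : ℂ) :
    kroneckerSum q y (q * x) = y⁻¹ * kroneckerSum q y x := by
  rw [kroneckerSum, kroneckerSum,
    ← (Equiv.addRight (1 : ℤ)).tsum_eq fun n => y ^ n / (1 - x * q ^ n), ← tsum_mul_left]
  refine tsum_congr fun n => ?_
  rw [Equiv.coe_addRight, zpow_add_one₀ hy0, zpow_add_one₀ hq0,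
    show q * x * q ^ n = x * (q ^ n * q) by ring, mul_comm (y ^ n), mul_div_assoc,
    inv_mul_cancel_left₀ hy0]

theorem analyticAt_kroneckerSum (hq0 : q ≠ 0) (hqy : ‖q‖ < ‖y‖) (hy : ‖y‖ < 1) (hx : x ≠ 0)
    (hθ : theta x q ≠ 0) : AnalyticAt ℂ (kroneckerSum q y) x :=
  analyticAt_tsum_div_one_sub_mul_zpow (e := id) hq0 (hqy.trans hy)
    (summable_norm_zpow_div_one_add hq0 hqy hy) hx
    fun n _ => (theta_ne_zero_iff hq0 (hqy.trans hy)).1 hθ n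

theorem zpow_eq_one_iff_of_norm_lt_one (hq1 : ‖q‖ < 1) {n : ℤ} : q ^ n = 1 ↔ n = 0 := by
  refine ⟨fun h => ?_, fun h => by rw [h, zpow_zero]⟩
  have hnorm := congrArg norm h
  rwa [norm_zpow, norm_one, zpow_eq_one_iff_right₀ (norm_nonneg q) hq1.ne] at hnorm

theorem hasSimplePoleAt_kroneckerSum (hq0 : q ≠ 0) (hqy : ‖q‖ < ‖y‖) (hy : ‖y‖ < 1) :
    HasSimplePoleAt (kroneckerSum q y) (-1) 1 := by
  have h := hasSimplePoleAt_tsum_div_one_sub_mul_zpow (x := 1) (e := id)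
    (i₀ := (0 : ℤ)) hq0 (hqy.trans hy) (summable_norm_zpow_div_one_add hq0 hqy hy) (by simp)
    fun n hn => by simpa [zpow_eq_one_iff_of_norm_lt_one (hqy.trans hy)] using hn
  rwa [zpow_zero, mul_one] at h

theorem theta_mul_div_theta_mul (hq0 : q ≠ 0) (hq1 : ‖q‖ < 1) (hy0 : y ≠ 0) (hx0 : x ≠ 0) :
    theta (y * (q * x)) q / theta (q * x) q = y⁻¹ * (theta (y * x) q / theta x q) := by
  rw [mul_left_comm, theta_mul hq0 hq1 (mul_ne_zero hy0 hx0), theta_mul hq0 hq1 hx0, mul_inv]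
  field_simp

theorem kroneckerSum_eq_theta_div (hq0 : q ≠ 0) (hqy : ‖q‖ < ‖y‖) (hy : ‖y‖ < 1) (hx : x ≠ 0)
    (hθx : theta x q ≠ 0) :
    kroneckerSum q y x = qPoch q q ^ 2 * theta (y * x) q / (theta x q * theta y q) := by
  have hq1 : ‖q‖ < 1 := hqy.trans hy
  have hqn : 0 < ‖q‖ := norm_pos_iff.2 hq0
  have hyn : 0 < ‖y‖ := hqn.trans hqy
  have hy0 : y ≠ 0 := norm_pos_iff.1 hyn
  have hθy : theta y q ≠ 0 := theta_ne_zero_of_norm_lt hq0 hqy hy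
  have hnum (a : ℂ) (ha : a ≠ 0) :
      AnalyticAt ℂ (fun w => qPoch q q ^ 2 / theta y q * theta (y * w) q) a :=
    analyticAt_const.mul (analyticAt_theta_comp hq1 (by fun_prop) (mul_ne_zero hy0 ha))
  set g := fun w => kroneckerSum q y w - qPoch q q ^ 2 / theta y q * theta (y * w) q *
    (theta w q)⁻¹ with hg
  have han (a : ℂ) (ha : a ≠ 0) (hθ : theta a q ≠ 0) : AnalyticAt ℂ g a :=
    (analyticAt_kroneckerSum hq0 hqy hy ha hθ).sub
      ((hnum a ha).mul ((analyticAt_theta_comp hq1 analyticAt_id ha).inv hθ))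
  have hzero : g x = 0 := by
    refine eq_zero_of_quasiperiodic (S := {1}) (φ := fun _ => y⁻¹) hq0 hq1 ?_ (fun a ha => ?_)
      (fun _ => analyticAt_const) (fun _ _ => inv_ne_zero hy0) ?_ (fun n hn => ?_)
      (fun a ha => ?_) hx (han x hx hθx).continuousAt
    · rintro _ rfl
      convert (hasSimplePoleAt_kroneckerSum hq0 hqy hy).sub
        ((hasSimplePoleAt_inv_theta hq1).analytic_mul (hnum 1 one_ne_zero)) using 1
      have := qPoch_self_ne_zero hq1
      rw [mul_one]
      field_simp
      ring
    · simpa using (em (theta a q = 0)).symm.imp (han a ha) (theta_eq_zero_iff hq0 hq1).1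
    · rwa [← div_eq_mul_inv, norm_div, div_lt_one hyn]
    · have hnorm := congrArg norm hn
      rw [norm_inv, norm_pow] at hnorm
      exact ((one_lt_inv₀ hyn).2 hy).not_ge (hnorm ▸ pow_le_one₀ hqn.le hq1.le)
    · filter_upwards [(eventually_ne_nhds ha).filter_mono nhdsWithin_le_nhds] with w hw
      linear_combination kroneckerSum_mul hq0 hy0 w - qPoch q q ^ 2 / theta y q *
        theta_mul_div_theta_mul hq0 hq1 hy0 hw
  rw [hg, sub_eq_zero] at hzero
  rw [hzero]
  field_simp

end KroneckerSum

section LerchSum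

variable {q u v : ℂ}

/-- The Lerch-type sum `∑_k (-1) ^ k q ^ (k²) u ^ k / (1 + q ^ (2 k) v)`. -/
def lerchSum (q u v : ℂ) : ℂ := ∑' k : ℤ, lerchTerm q u v k

theorem lerchTerm_eq_div (q u v : ℂ) (k : ℤ) :
    lerchTerm q u v k = thetaTerm q u k / (1 + v * (q ^ 2) ^ k) := by
  rw [lerchTerm, thetaTerm, zpow_mul, zpow_ofNat, mul_comm v]

theorem one_add_mul_zpow_ne_zero (hq0 : q ≠ 0) (hq1 : ‖q‖ < 1) (hθ : theta (-v) (q ^ 2) ≠ 0)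
    (k : ℤ) : 1 + v * (q ^ 2) ^ k ≠ 0 := fun h =>
  (theta_ne_zero_iff (pow_ne_zero 2 hq0) (norm_sq_lt_one hq1)).1 hθ k (by linear_combination -h)

theorem thetaTerm_inv_neg (q u : ℂ) (k : ℤ) : thetaTerm q u⁻¹ (-k) = thetaTerm q u k := by
  rw [thetaTerm, thetaTerm, neg_sq, inv_zpow', neg_neg, zpow_neg, ← inv_zpow, inv_neg_one]

theorem thetaSum_inv (q u : ℂ) : thetaSum q u⁻¹ = thetaSum q u := by
  rw [thetaSum, thetaSum, ← (Equiv.neg ℤ).tsum_eq (thetaTerm q u⁻¹)]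
  exact tsum_congr (thetaTerm_inv_neg q u)

theorem summable_norm_lerchTerm (hq0 : q ≠ 0) (hq1 : ‖q‖ < 1) (u : ℂ) (hv : v ≠ 0) :
    Summable fun k => ‖lerchTerm q u v k‖ := by
  simpa only [lerchTerm_eq_div, neg_mul, sub_neg_eq_add, id] using
    summable_norm_div_one_sub_mul_zpow (e := id) (pow_ne_zero 2 hq0) (norm_sq_lt_one hq1)
      (summable_norm_div_one_add_zpow _ _ (summable_norm_thetaTerm hq0 hq1 u)) (neg_ne_zero.2 hv)

theorem lerchSum_mul_right (hq0 : q ≠ 0) (hq1 : ‖q‖ < 1) (hu : u ≠ 0) (hv : v ≠ 0)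
    (hθ : theta (-v) (q ^ 2) ≠ 0) :
    lerchSum q u (q ^ 2 * v) = thetaSum q u + q / u * v * lerchSum q u v := by
  have hshift := (Equiv.addRight (1 : ℤ)).hasSum_iff.2
    (summable_norm_lerchTerm hq0 hq1 u hv).of_norm.hasSum
  rw [lerchSum, thetaSum, lerchSum, ← ((summable_norm_thetaTerm hq0 hq1 u).of_norm.hasSum.add
    (hshift.mul_left (q / u * v))).tsum_eq]
  refine tsum_congr fun k => ?_
  have hden := one_add_mul_zpow_ne_zero hq0 hq1 hθ (k + 1)
  rw [Function.comp_apply, Equiv.coe_addRight, lerchTerm_eq_div, lerchTerm_eq_div,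
    thetaTerm_add_one hq0 hu]
  rw [zpow_add_one₀ (pow_ne_zero 2 hq0)] at hden ⊢
  rw [mul_comm (q ^ 2) v, mul_assoc, mul_comm (q ^ 2) ((q ^ 2) ^ k), ← sub_eq_iff_eq_add,
    ← mul_div_assoc, ← sub_div, div_eq_iff hden]
  field_simp
  ring

theorem lerchSum_mul_left (hq0 : q ≠ 0) (hq1 : ‖q‖ < 1) (hv : v ≠ 0)
    (hθ : theta (-v) (q ^ 2) ≠ 0) :
    lerchSum q (q ^ 2 * u) v = v⁻¹ * (thetaSum q u - lerchSum q u v) := by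
  rw [lerchSum, thetaSum, lerchSum, ← ((summable_norm_thetaTerm hq0 hq1 u).of_norm.tsum_sub
    (summable_norm_lerchTerm hq0 hq1 u hv).of_norm), ← tsum_mul_left]
  refine tsum_congr fun k => ?_
  have hden := one_add_mul_zpow_ne_zero hq0 hq1 hθ k
  rw [lerchTerm_eq_div, lerchTerm_eq_div, thetaTerm, thetaTerm, mul_zpow, sub_div' hden,
    ← mul_div_assoc]
  congr 1
  field_simp
  ring

theorem lerchSum_add_inv (hq0 : q ≠ 0) (hq1 : ‖q‖ < 1) (hv : v ≠ 0)
    (hθ : theta (-v) (q ^ 2) ≠ 0) :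
    lerchSum q u v + lerchSum q u⁻¹ v⁻¹ = thetaSum q u := by
  have hneg := (Equiv.neg ℤ).hasSum_iff.2
    (summable_norm_lerchTerm hq0 hq1 u⁻¹ (inv_ne_zero hv)).of_norm.hasSum
  rw [lerchSum, lerchSum, thetaSum,
    ← ((summable_norm_lerchTerm hq0 hq1 u hv).of_norm.hasSum.add hneg).tsum_eq]
  refine tsum_congr fun k => ?_
  have hden := one_add_mul_zpow_ne_zero hq0 hq1 hθ k
  have hpow : (q ^ 2) ^ k ≠ 0 := zpow_ne_zero _ (pow_ne_zero 2 hq0)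
  have hden' : 1 + v⁻¹ * ((q ^ 2) ^ k)⁻¹ = (1 + v * (q ^ 2) ^ k) / (v * (q ^ 2) ^ k) := by
    field_simp
    ring
  rw [Function.comp_apply, Equiv.neg_apply, lerchTerm_eq_div, lerchTerm_eq_div,
    thetaTerm_inv_neg, zpow_neg, hden']
  field_simp

theorem analyticAt_lerchSum_right (hq0 : q ≠ 0) (hq1 : ‖q‖ < 1) (u : ℂ) (hv : v ≠ 0)
    (hθ : theta (-v) (q ^ 2) ≠ 0) : AnalyticAt ℂ (fun w => lerchSum q u w) v := by
  have h := (analyticAt_tsum_div_one_sub_mul_zpow (e := id) (pow_ne_zero 2 hq0)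
    (norm_sq_lt_one hq1)
    (summable_norm_div_one_add_zpow _ _ (summable_norm_thetaTerm hq0 hq1 u)) (neg_ne_zero.2 hv)
    fun k _ => (theta_ne_zero_iff (pow_ne_zero 2 hq0) (norm_sq_lt_one hq1)).1 hθ k).comp
      (f := fun w => -w) (by fun_prop)
  simpa only [lerchSum, lerchTerm_eq_div, Function.comp_def, neg_mul, sub_neg_eq_add, id] using h

theorem hasSimplePoleAt_lerchSum_right (hq0 : q ≠ 0) (hq1 : ‖q‖ < 1) (u : ℂ) :
    HasSimplePoleAt (fun w => lerchSum q u w) 1 (-1) := by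
  have h := hasSimplePoleAt_tsum_div_one_sub_mul_zpow (x := -1 * -1) (e := id) (i₀ := (0 : ℤ))
    (pow_ne_zero 2 hq0) (norm_sq_lt_one hq1)
    (summable_norm_div_one_add_zpow _ _ (summable_norm_thetaTerm hq0 hq1 u)) (by simp)
    fun n hn => by simpa [zpow_eq_one_iff_of_norm_lt_one (norm_sq_lt_one hq1)] using hn
  simpa [lerchSum, lerchTerm_eq_div, thetaTerm] using h.comp_const_mul (by norm_num)

theorem analyticAt_lerchSum_left (hq0 : q ≠ 0) (hq1 : ‖q‖ < 1) (hu : u ≠ 0) (hv : v ≠ 0)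
    (hθ : theta (-v) (q ^ 2) ≠ 0) : AnalyticAt ℂ (fun w => lerchSum q w v) u := by
  obtain ⟨C, hC0, hC⟩ := exists_one_add_norm_zpow_le (pow_ne_zero 2 hq0) (norm_sq_lt_one hq1)
    (neg_ne_zero.2 hv)
  have hun : 0 < ‖u‖ := norm_pos_iff.2 hu
  obtain ⟨r, hr, hball⟩ := Metric.eventually_nhds_iff_ball.1
    ((continuousAt_id.norm.eventually_lt_const (show ‖u‖ < 2 * ‖u‖ by linarith)).and
      (continuousAt_id.norm.eventually_const_lt (show ‖u‖ / 2 < ‖u‖ by linarith)))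
  have hpos : 0 < max (2 * ‖u‖) (‖u‖ / 2)⁻¹ := lt_max_of_lt_left (by positivity)
  refine (Complex.differentiableOn_tsum_of_summable_norm ((summable_zpow_sq_mul_pow_natAbs
    (norm_pos_iff.2 hq0) hq1 hpos.le).mul_left C) (fun k w hw => ?_) Metric.isOpen_ball
    (fun k w hw => ?_)).analyticAt (Metric.ball_mem_nhds u hr) <;> obtain ⟨hle, hge⟩ := hball w hw
  · have hw0 : w ≠ 0 := norm_pos_iff.1 ((by positivity : 0 < ‖u‖ / 2).trans hge)
    exact (((differentiableAt_zpow.2 (Or.inl hw0)).const_mul _).div_const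
      _).differentiableWithinAt
  · rw [lerchTerm_eq_div, ← sub_neg_eq_add, ← neg_mul]
    calc ‖thetaTerm q w k / (1 - -v * (q ^ 2) ^ k)‖
        ≤ C * (‖thetaTerm q w k‖ / (1 + ‖q ^ 2‖ ^ k)) :=
          norm_div_le_of_le_mul_norm (by positivity)
            (hC k ((theta_ne_zero_iff (pow_ne_zero 2 hq0) (norm_sq_lt_one hq1)).1 hθ k))
      _ ≤ C * ‖thetaTerm q w k‖ := by
          gcongr
          exact div_le_self (norm_nonneg _) (le_add_of_nonneg_right (by positivity))
      _ ≤ C * (‖q‖ ^ (k ^ 2) * max (2 * ‖u‖) (‖u‖ / 2)⁻¹ ^ k.natAbs) := by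
          gcongr
          exact norm_thetaTerm_le (le_max_of_le_left hle.le)
            (le_max_of_le_right (inv_anti₀ (by positivity) hge.le)) k

end LerchSum

section ChangeOfBase

variable {q c u v : ℂ}

/-- The Lerch sum normalised by the theta series, `∑_k (-1) ^ k q ^ (k²) u ^ k / (1 + q ^ (2 k) v)`
divided by `∑_k (-1) ^ k q ^ (k²) u ^ k`. It satisfies an inhomogeneous functional equation whose
inhomogeneity does not depend on `u`, so differences of such quotients are theta quotients. -/
def appellLerch (q u v : ℂ) : ℂ := lerchSum q u v / thetaSum q u

theorem thetaSum_ne_zero (hq0 : q ≠ 0) (hq1 : ‖q‖ < 1) (hu : u ≠ 0)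
    (hθ : theta (q * u) (q ^ 2) ≠ 0) : thetaSum q u ≠ 0 := by
  rw [thetaSum_eq_qPoch_mul_theta hq0 hq1 hu]
  exact mul_ne_zero (qPoch_self_ne_zero (norm_sq_lt_one hq1)) hθ

theorem appellLerch_mul_right (hq0 : q ≠ 0) (hq1 : ‖q‖ < 1) (hu : u ≠ 0) (hv : v ≠ 0)
    (hθu : theta (q * u) (q ^ 2) ≠ 0) (hθ : theta (-v) (q ^ 2) ≠ 0) :
    appellLerch q u (q ^ 2 * v) = 1 + q / u * v * appellLerch q u v := by
  rw [appellLerch, lerchSum_mul_right hq0 hq1 hu hv hθ, add_div,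
    div_self (thetaSum_ne_zero hq0 hq1 hu hθu), mul_div_assoc, appellLerch]

theorem appellLerch_add_inv (hq0 : q ≠ 0) (hq1 : ‖q‖ < 1) (hu : u ≠ 0) (hv : v ≠ 0)
    (hθu : theta (q * u) (q ^ 2) ≠ 0) (hθ : theta (-v) (q ^ 2) ≠ 0) :
    appellLerch q u v + appellLerch q u⁻¹ v⁻¹ = 1 := by
  rw [appellLerch, appellLerch, thetaSum_inv, ← add_div, lerchSum_add_inv hq0 hq1 hv hθ,
    div_self (thetaSum_ne_zero hq0 hq1 hu hθu)]

theorem analyticAt_appellLerch_right (hq0 : q ≠ 0) (hq1 : ‖q‖ < 1) (u : ℂ) (hv : v ≠ 0)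
    (hθ : theta (-v) (q ^ 2) ≠ 0) : AnalyticAt ℂ (appellLerch q u) v :=
  (analyticAt_lerchSum_right hq0 hq1 u hv hθ).div_const

theorem hasSimplePoleAt_appellLerch_right (hq0 : q ≠ 0) (hq1 : ‖q‖ < 1) (u : ℂ) :
    HasSimplePoleAt (appellLerch q u) (thetaSum q u)⁻¹ (-1) := by
  have h := (hasSimplePoleAt_lerchSum_right hq0 hq1 u).const_mul (thetaSum q u)⁻¹
  simp only [mul_one, inv_mul_eq_div] at h
  exact h

theorem eventually_theta_const_mul_ne_zero {p b : ℂ} (hp0 : p ≠ 0) (hp1 : ‖p‖ < 1) (hb : b ≠ 0)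
    (hv : v ≠ 0) : ∀ᶠ w in 𝓝[≠] v, theta (b * w) p ≠ 0 :=
  (tendsto_const_mul_nhdsNE hb).eventually (eventually_theta_ne_zero hp0 hp1 (mul_ne_zero hb hv))

theorem hasSimplePoleAt_inv_theta_const_mul {p b : ℂ} (hp1 : ‖p‖ < 1) (hb : b ≠ 0) :
    HasSimplePoleAt (fun w => (theta (b * w) p)⁻¹) (-(b * qPoch p p ^ 2)⁻¹) b⁻¹ := by
  have h := HasSimplePoleAt.comp_const_mul (a := b⁻¹) hb
    (by rw [mul_inv_cancel₀ hb]; exact hasSimplePoleAt_inv_theta hp1)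
  convert h using 1
  rw [mul_inv, neg_div, div_eq_mul_inv, mul_comm]

/-- The theta quotient by which a normalised Lerch sum changes when both of its arguments are
multiplied by `c`. -/
def baseChange (q c u v : ℂ) : ℂ :=
  -(qPoch (q ^ 2) (q ^ 2) * theta c (q ^ 2) / (theta (q * u) (q ^ 2) * theta (q * (c * u)) (q ^ 2)))
    * (v * theta (-(q * (c * u)) * v) (q ^ 2)) * (theta (-v) (q ^ 2))⁻¹ * (theta (-c * v) (q ^ 2))⁻¹

theorem baseChange_mul_sq (hq0 : q ≠ 0) (hq1 : ‖q‖ < 1) (hc : c ≠ 0) (hu : u ≠ 0) (hv : v ≠ 0) :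
    baseChange q c u (q ^ 2 * v) = q / u * v * baseChange q c u v := by
  have hp0 := pow_ne_zero 2 hq0
  have hp1 := norm_sq_lt_one hq1
  rw [baseChange, baseChange, mul_left_comm (-c), mul_left_comm (-(q * (c * u))), ← mul_neg _ v,
    theta_mul hp0 hp1 (neg_ne_zero.2 hv),
    theta_mul hp0 hp1 (mul_ne_zero (neg_ne_zero.2 hc) hv),
    theta_mul hp0 hp1 (mul_ne_zero (neg_ne_zero.2 (mul_ne_zero hq0 (mul_ne_zero hc hu))) hv)]
  simp only [mul_inv, inv_neg, inv_inv]
  field_simp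

theorem analyticAt_baseChange_num (hq0 : q ≠ 0) (hq1 : ‖q‖ < 1) (hc : c ≠ 0) (hu : u ≠ 0)
    (hv : v ≠ 0) : AnalyticAt ℂ (fun w => -(qPoch (q ^ 2) (q ^ 2) * theta c (q ^ 2) /
      (theta (q * u) (q ^ 2) * theta (q * (c * u)) (q ^ 2)))
        * (w * theta (-(q * (c * u)) * w) (q ^ 2))) v :=
  analyticAt_const.mul (analyticAt_id.mul (analyticAt_theta_comp (norm_sq_lt_one hq1)
    (by fun_prop) (mul_ne_zero (neg_ne_zero.2 (mul_ne_zero hq0 (mul_ne_zero hc hu))) hv)))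

theorem analyticAt_inv_theta_const_mul {p b : ℂ} (hp1 : ‖p‖ < 1) (hb : b ≠ 0) (hv : v ≠ 0)
    (hθ : theta (b * v) p ≠ 0) : AnalyticAt ℂ (fun w => (theta (b * w) p)⁻¹) v :=
  (analyticAt_theta_comp hp1 (by fun_prop) (mul_ne_zero hb hv)).inv hθ

theorem analyticAt_baseChange (hq0 : q ≠ 0) (hq1 : ‖q‖ < 1) (hc : c ≠ 0) (hu : u ≠ 0)
    (hv : v ≠ 0) (hθ : theta (-v) (q ^ 2) ≠ 0) (hθc : theta (-c * v) (q ^ 2) ≠ 0) :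
    AnalyticAt ℂ (baseChange q c u) v := by
  rw [neg_eq_neg_one_mul] at hθ
  have hinv := analyticAt_inv_theta_const_mul (norm_sq_lt_one hq1) (by norm_num) hv hθ
  simp only [neg_one_mul] at hinv
  exact ((analyticAt_baseChange_num hq0 hq1 hc hu hv).mul hinv).mul
    (analyticAt_inv_theta_const_mul (norm_sq_lt_one hq1) (neg_ne_zero.2 hc) hv hθc)

theorem hasSimplePoleAt_baseChange_neg_one (hq0 : q ≠ 0) (hq1 : ‖q‖ < 1) (hc : c ≠ 0) (hu : u ≠ 0)
    (hθc : theta c (q ^ 2) ≠ 0) (hθcu : theta (q * (c * u)) (q ^ 2) ≠ 0) :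
    HasSimplePoleAt (baseChange q c u) (thetaSum q u)⁻¹ (-1) := by
  have hp1 := norm_sq_lt_one hq1
  have hP := qPoch_self_ne_zero hp1
  have hpole := (hasSimplePoleAt_inv_theta_const_mul hp1 (b := -1) (by norm_num)).analytic_mul
    ((analyticAt_baseChange_num hq0 hq1 hc hu (by norm_num)).mul
      (analyticAt_inv_theta_const_mul hp1 (v := (-1)⁻¹) (neg_ne_zero.2 hc) (by norm_num)
        (by norm_num [hθc])))
  norm_num at hpole
  convert hpole using 1
  · funext w
    rw [baseChange]
    norm_num
    ring
  · rw [thetaSum_eq_qPoch_mul_theta hq0 hq1 hu]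
    generalize theta (q * (c * u)) (q ^ 2) = A at hθcu
    field_simp

theorem baseChange_inv (hq0 : q ≠ 0) (hq1 : ‖q‖ < 1) (hc : c ≠ 0) (v : ℂ) :
    baseChange q c⁻¹ (c * u) (c * v) = -baseChange q c u v := by
  rw [baseChange, baseChange, theta_inv (pow_ne_zero 2 hq0) (norm_sq_lt_one hq1) hc,
    inv_mul_cancel_left₀ hc, neg_mul c⁻¹ (c * v), inv_mul_cancel_left₀ hc, ← neg_mul c v,
    show -(q * u) * (c * v) = -(q * (c * u)) * v by ring]
  field_simp

theorem hasSimplePoleAt_baseChange_neg_inv (hq0 : q ≠ 0) (hq1 : ‖q‖ < 1) (hc : c ≠ 0) (hu : u ≠ 0)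
    (hθc : theta c⁻¹ (q ^ 2) ≠ 0) (hθu : theta (q * u) (q ^ 2) ≠ 0) :
    HasSimplePoleAt (baseChange q c u) (-((thetaSum q (c * u))⁻¹ / c)) (c⁻¹ * -1) := by
  have hpole := (HasSimplePoleAt.comp_const_mul (a := c⁻¹ * -1) hc (by
    rw [mul_inv_cancel_left₀ hc]
    exact hasSimplePoleAt_baseChange_neg_one hq0 hq1 (inv_ne_zero hc) (mul_ne_zero hc hu) hθc
      (by rwa [inv_mul_cancel_left₀ hc]))).const_mul (-1)
  simpa only [baseChange_inv hq0 hq1 hc, neg_one_mul, neg_neg] using hpole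

theorem analyticAt_appellLerch_const_mul_right (hq0 : q ≠ 0) (hq1 : ‖q‖ < 1) (u : ℂ) (hc : c ≠ 0)
    (hv : v ≠ 0) (hθ : theta (-c * v) (q ^ 2) ≠ 0) :
    AnalyticAt ℂ (fun w => appellLerch q u (c * w)) v :=
  (analyticAt_appellLerch_right hq0 hq1 u (mul_ne_zero hc hv) (by rwa [← neg_mul])).fun_comp
    (by fun_prop)

/-- The difference of the two sides of `appellLerch_sub_mul`. It is quasi-periodic in `v`, so it
vanishes once its residues do. -/
def baseChangeDefect (q c u v : ℂ) : ℂ :=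
  appellLerch q u v - appellLerch q (c * u) (c * v) - baseChange q c u v

theorem baseChangeDefect_mul_sq (hq0 : q ≠ 0) (hq1 : ‖q‖ < 1) (hc : c ≠ 0) (hu : u ≠ 0)
    (hv : v ≠ 0) (hθu : theta (q * u) (q ^ 2) ≠ 0) (hθcu : theta (q * (c * u)) (q ^ 2) ≠ 0)
    (hθv : theta (-v) (q ^ 2) ≠ 0) (hθcv : theta (-c * v) (q ^ 2) ≠ 0) :
    baseChangeDefect q c u (q ^ 2 * v) = q / u * v * baseChangeDefect q c u v := by
  rw [baseChangeDefect, baseChangeDefect, mul_left_comm c,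
    appellLerch_mul_right hq0 hq1 hu hv hθu hθv,
    appellLerch_mul_right hq0 hq1 (mul_ne_zero hc hu) (mul_ne_zero hc hv) hθcu
      (by rwa [← neg_mul]), baseChange_mul_sq hq0 hq1 hc hu hv]
  field_simp
  ring

theorem analyticAt_baseChangeDefect (hq0 : q ≠ 0) (hq1 : ‖q‖ < 1) (hc : c ≠ 0) (hu : u ≠ 0)
    (hv : v ≠ 0) (hθv : theta (-v) (q ^ 2) ≠ 0) (hθcv : theta (-c * v) (q ^ 2) ≠ 0) :
    AnalyticAt ℂ (baseChangeDefect q c u) v :=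
  ((analyticAt_appellLerch_right hq0 hq1 u hv hθv).sub
    (analyticAt_appellLerch_const_mul_right hq0 hq1 (c * u) hc hv hθcv)).sub
      (analyticAt_baseChange hq0 hq1 hc hu hv hθv hθcv)

theorem hasSimplePoleAt_baseChangeDefect_neg_one (hq0 : q ≠ 0) (hq1 : ‖q‖ < 1) (hc : c ≠ 0)
    (hu : u ≠ 0) (hθc : theta c (q ^ 2) ≠ 0) (hθcu : theta (q * (c * u)) (q ^ 2) ≠ 0) :
    HasSimplePoleAt (baseChangeDefect q c u) 0 (-1) := by
  convert ((hasSimplePoleAt_appellLerch_right hq0 hq1 u).sub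
    (hasSimplePoleAt_of_analyticAt (analyticAt_appellLerch_const_mul_right hq0 hq1 (c * u) hc
      (neg_ne_zero.2 one_ne_zero) (by simpa using hθc)))).sub
      (hasSimplePoleAt_baseChange_neg_one hq0 hq1 hc hu hθc hθcu) using 1
  · rfl
  · ring

theorem hasSimplePoleAt_baseChangeDefect_neg_inv (hq0 : q ≠ 0) (hq1 : ‖q‖ < 1) (hc : c ≠ 0)
    (hu : u ≠ 0) (hθc : theta c⁻¹ (q ^ 2) ≠ 0) (hθu : theta (q * u) (q ^ 2) ≠ 0) :
    HasSimplePoleAt (baseChangeDefect q c u) 0 (c⁻¹ * -1) := by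
  convert ((hasSimplePoleAt_of_analyticAt (analyticAt_appellLerch_right hq0 hq1 u
    (v := c⁻¹ * -1) (by simpa using hc) (by simpa using hθc))).sub
    (HasSimplePoleAt.comp_const_mul hc (by
      rw [mul_inv_cancel_left₀ hc]
      exact hasSimplePoleAt_appellLerch_right hq0 hq1 (c * u)))).sub
    (hasSimplePoleAt_baseChange_neg_inv hq0 hq1 hc hu hθc hθu) using 1
  · rfl
  · ring

theorem appellLerch_sub_mul (hq0 : q ≠ 0) (hq1 : ‖q‖ < 1) (hc : c ≠ 0) (hu : u ≠ 0) (hv : v ≠ 0)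
    (hθc : theta c (q ^ 2) ≠ 0) (hθu : theta (q * u) (q ^ 2) ≠ 0)
    (hθcu : theta (q * (c * u)) (q ^ 2) ≠ 0) (hθv : theta (-v) (q ^ 2) ≠ 0)
    (hθcv : theta (-c * v) (q ^ 2) ≠ 0) :
    appellLerch q u v - appellLerch q (c * u) (c * v) = baseChange q c u v := by
  have hp0 := pow_ne_zero 2 hq0
  have hp1 := norm_sq_lt_one hq1
  have hθc' : theta c⁻¹ (q ^ 2) ≠ 0 := by
    rw [theta_inv hp0 hp1 hc]
    exact mul_ne_zero (neg_ne_zero.2 (inv_ne_zero hc)) hθc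
  suffices h : baseChangeDefect q c u v = 0 from sub_eq_zero.1 h
  refine eq_zero_of_quasiperiodic (S := {-1, c⁻¹ * -1}) (φ := fun w => q / u * w) hp0 hp1 ?_
    (fun a ha => ?_) (fun _ => by fun_prop) (fun w hw => mul_ne_zero (div_ne_zero hq0 hu) hw)
    (by simp) (fun n => by simpa using (pow_ne_zero n hp0).symm) (fun a ha => ?_) hv
    (analyticAt_baseChangeDefect hq0 hq1 hc hu hv hθv hθcv).continuousAt
  · rintro _ (rfl | rfl)
    · exact hasSimplePoleAt_baseChangeDefect_neg_one hq0 hq1 hc hu hθc hθcu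
    · exact hasSimplePoleAt_baseChangeDefect_neg_inv hq0 hq1 hc hu hθc' hθu
  · by_cases h : theta (-a) (q ^ 2) = 0
    · obtain ⟨n, hn⟩ := (theta_eq_zero_iff hp0 hp1).1 h
      exact Or.inr ⟨-1, by simp, n, by linear_combination -hn⟩
    by_cases h' : theta (-c * a) (q ^ 2) = 0
    · obtain ⟨n, hn⟩ := (theta_eq_zero_iff hp0 hp1).1 h'
      exact Or.inr ⟨c⁻¹ * -1, by simp, n, by rw [← hn]; field_simp⟩
    exact Or.inl (analyticAt_baseChangeDefect hq0 hq1 hc hu ha h h')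
  · filter_upwards [(eventually_ne_nhds ha).filter_mono nhdsWithin_le_nhds,
      eventually_theta_const_mul_ne_zero hp0 hp1 (neg_ne_zero.2 one_ne_zero) ha,
      eventually_theta_const_mul_ne_zero hp0 hp1 (neg_ne_zero.2 hc) ha] with w hw hθ hθ'
    rw [neg_one_mul] at hθ
    exact baseChangeDefect_mul_sq hq0 hq1 hc hu hw hθu hθcu hθ hθ'

end ChangeOfBase

section Reflection

variable {q u v u' v' y z : ℂ}

theorem theta_mul_inv (hq0 : q ≠ 0) (u : ℂ) :
    theta (q * u⁻¹) (q ^ 2) = theta (q * u) (q ^ 2) := by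
  rw [← theta_div (q * u) (pow_ne_zero 2 hq0), pow_two, mul_div_mul_left q u hq0, div_eq_mul_inv]

/-- The base change by `c = (u u')⁻¹` sends `(u, v)` to `(u'⁻¹, v'⁻¹)`. -/
theorem appellLerch_add_of_mul_eq_mul (hq0 : q ≠ 0) (hq1 : ‖q‖ < 1) (hu : u ≠ 0) (hu' : u' ≠ 0)
    (hv : v ≠ 0) (hv' : v' ≠ 0) (h : u * u' = v * v') (hθ : theta (u * u') (q ^ 2) ≠ 0)
    (hθu : theta (q * u) (q ^ 2) ≠ 0) (hθu' : theta (q * u') (q ^ 2) ≠ 0)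
    (hθv : theta (-v) (q ^ 2) ≠ 0) (hθv' : theta (-v') (q ^ 2) ≠ 0) :
    appellLerch q u v + appellLerch q u' v' = 1 + qPoch (q ^ 2) (q ^ 2) *
      (theta (u * u') (q ^ 2) * theta (-(q * v / u')) (q ^ 2)) /
        (theta (q * u) (q ^ 2) * theta (q * u') (q ^ 2) *
          (theta (-v) (q ^ 2) * theta (-v') (q ^ 2))) := by
  have hp0 := pow_ne_zero 2 hq0
  have hp1 := norm_sq_lt_one hq1
  have hc := inv_ne_zero (mul_ne_zero hu hu')
  have hcu : (u * u')⁻¹ * u = u'⁻¹ := by field_simp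
  have hcv : (u * u')⁻¹ * v = v'⁻¹ := by rw [h]; field_simp
  have hθc : theta (u * u')⁻¹ (q ^ 2) = -(u * u')⁻¹ * theta (u * u') (q ^ 2) :=
    theta_inv hp0 hp1 (mul_ne_zero hu hu')
  have hθcv : theta (-v'⁻¹) (q ^ 2) = v'⁻¹ * theta (-v') (q ^ 2) := by
    rw [← inv_neg, theta_inv hp0 hp1 (neg_ne_zero.2 hv'), inv_neg, neg_neg]
  have hbase := appellLerch_sub_mul hq0 hq1 hc hu hv
    (hθc ▸ mul_ne_zero (neg_ne_zero.2 hc) hθ) hθu (by rwa [hcu, theta_mul_inv hq0]) hθv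
    (by rw [neg_mul, hcv, hθcv]; exact mul_ne_zero (inv_ne_zero hv') hθv')
  rw [baseChange, hcu, hcv, theta_mul_inv hq0, hθc, neg_mul (u * u')⁻¹ v, hcv, hθcv,
    show -(q * u'⁻¹) * v = -(q * v / u') by ring] at hbase
  rw [← sub_eq_iff_eq_add', ← appellLerch_add_inv hq0 hq1 hu' hv' hθu' hθv',
    add_comm (appellLerch q u v), add_sub_add_left_eq_sub, hbase, h]
  field_simp

theorem appellLerch_add_swap (hq0 : q ≠ 0) (hq1 : ‖q‖ < 1) (hy : y ≠ 0) (hz : z ≠ 0)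
    (hθ : theta (y * z) (q ^ 2) ≠ 0) (hθy : theta (q * y) (q ^ 2) ≠ 0)
    (hθz : theta (q * z) (q ^ 2) ≠ 0) (hθy' : theta (-y) (q ^ 2) ≠ 0)
    (hθz' : theta (-z) (q ^ 2) ≠ 0) :
    appellLerch q y z + appellLerch q z y = 1 + qPoch (q ^ 2) (q ^ 2) *
      (theta (y * z) (q ^ 2) * theta (-q) (q ^ 2)) / (theta (q * y) (q ^ 2) *
        theta (q * z) (q ^ 2) * (theta (-y) (q ^ 2) * theta (-z) (q ^ 2))) := by
  rw [appellLerch_add_of_mul_eq_mul hq0 hq1 hy hz hz hy (mul_comm y z) hθ hθy hθz hθz' hθy',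
    mul_div_cancel_right₀ q hz, mul_comm (theta (-z) _)]

theorem mul_appellLerch_add_swap (hq0 : q ≠ 0) (hq1 : ‖q‖ < 1) (hy : y ≠ 0) (hz : z ≠ 0)
    (hθ : theta (y * z) (q ^ 2) ≠ 0) (hθy : theta y (q ^ 2) ≠ 0) (hθz : theta z (q ^ 2) ≠ 0)
    (hθy' : theta (-y) (q ^ 2) ≠ 0) (hθz' : theta (-z) (q ^ 2) ≠ 0) :
    z * appellLerch q (q * y) z + y * appellLerch q (q * z) y =
      -(y * z) * (qPoch (q ^ 2) (q ^ 2) * (theta (y * z) (q ^ 2) * theta (-1) (q ^ 2)) /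
        (theta y (q ^ 2) * theta z (q ^ 2) * (theta (-y) (q ^ 2) * theta (-z) (q ^ 2)))) := by
  have hp0 := pow_ne_zero 2 hq0
  have hp1 := norm_sq_lt_one hq1
  have hshift {w : ℂ} (hw : w ≠ 0) : theta (q * (q * w)) (q ^ 2) = -w⁻¹ * theta w (q ^ 2) := by
    rw [← theta_mul hp0 hp1 hw, pow_two, mul_assoc]
  have hshift' {w : ℂ} (hw : w ≠ 0) (h : theta w (q ^ 2) ≠ 0) :
      theta (q * (q * w)) (q ^ 2) ≠ 0 := by
    rw [hshift hw]
    exact mul_ne_zero (neg_ne_zero.2 (inv_ne_zero hw)) h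
  have hneg : theta (-(q ^ 2 * y)) (q ^ 2) = y⁻¹ * theta (-y) (q ^ 2) := by
    rw [← mul_neg, theta_mul hp0 hp1 (neg_ne_zero.2 hy), inv_neg, neg_neg]
  have hprod : q * y * (q * z) = q * (q * (y * z)) := by ring
  have h := appellLerch_add_of_mul_eq_mul hq0 hq1 (mul_ne_zero hq0 hy) (mul_ne_zero hq0 hz) hz
    (mul_ne_zero hp0 hy) (by ring) (hprod ▸ hshift' (mul_ne_zero hy hz) hθ) (hshift' hy hθy)
    (hshift' hz hθz) hθz' (hneg ▸ mul_ne_zero (inv_ne_zero hy) hθy')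
  rw [appellLerch_mul_right hq0 hq1 (mul_ne_zero hq0 hz) hy (hshift' hz hθz) hθy', hprod,
    hshift (mul_ne_zero hy hz), hshift hy, hshift hz, hneg,
    div_self (mul_ne_zero hq0 hz), ← add_assoc, add_right_comm, add_comm _ (1 : ℂ), add_right_inj,
    div_mul_cancel_left₀ hq0] at h
  calc z * appellLerch q (q * y) z + y * appellLerch q (q * z) y
      = z * (appellLerch q (q * y) z + z⁻¹ * y * appellLerch q (q * z) y) := by field_simp
    _ = _ := by
      rw [h]
      field_simp

end Reflection

section DoubleSum

variable {q x y z : ℂ}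

/-- The numerator `q ^ (s t) y ^ s z ^ t` of `Kronecker.term`. -/
def termNum (q y z : ℂ) (s t : ℤ) : ℂ := q ^ (s * t) * y ^ s * z ^ t

theorem termNum_natCast (q y z : ℂ) (m n : ℕ) :
    termNum q y z m n = q ^ (m * n) * y ^ m * z ^ n := by
  rw [termNum, ← Nat.cast_mul, zpow_natCast, zpow_natCast, zpow_natCast]

theorem termNum_neg_succ (hq0 : q ≠ 0) (hy0 : y ≠ 0) (hz0 : z ≠ 0) (m n : ℕ) :
    termNum q y z (-((m : ℤ) + 1)) (-((n : ℤ) + 1)) =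
      q / (y * z) * termNum q (q / y) (q / z) m n := by
  have hexp : -((m : ℤ) + 1) * -((n : ℤ) + 1) = ((m * n + m + n + 1 : ℕ) : ℤ) := by
    push_cast
    ring
  rw [termNum_natCast, termNum, hexp, zpow_natCast, ← Nat.cast_succ, ← Nat.cast_succ, zpow_neg,
    zpow_neg, zpow_natCast, zpow_natCast, pow_succ, pow_add, pow_add, pow_succ y, pow_succ z,
    div_pow, div_pow]
  field_simp

theorem summable_norm_termNum (hq1 : ‖q‖ < 1) (hy : ‖y‖ < 1) (hz : ‖z‖ < 1) :
    Summable fun p : ℕ × ℕ => ‖termNum q y z p.1 p.2‖ := by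
  refine ((summable_geometric_of_lt_one (norm_nonneg y) hy).mul_of_nonneg
    (summable_geometric_of_lt_one (norm_nonneg z) hz) (fun _ => by positivity)
    (fun _ => by positivity)).of_nonneg_of_le (fun p => norm_nonneg _) (fun p => ?_)
  rw [termNum_natCast, norm_mul, norm_mul, norm_pow, norm_pow, norm_pow, mul_assoc]
  exact mul_le_of_le_one_left (by positivity) (pow_le_one₀ (norm_nonneg _) hq1.le)

theorem summable_norm_termNum_neg (hq0 : q ≠ 0) (hq1 : ‖q‖ < 1) (hqy : ‖q‖ < ‖y‖)
    (hqz : ‖q‖ < ‖z‖) :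
    Summable fun p : ℕ × ℕ => ‖termNum q y z (-((p.1 : ℤ) + 1)) (-((p.2 : ℤ) + 1))‖ := by
  have hyn := (norm_pos_iff.2 hq0).trans hqy
  have hzn := (norm_pos_iff.2 hq0).trans hqz
  have h := (summable_norm_termNum (y := q / y) (z := q / z) hq1
    (by rwa [norm_div, div_lt_one hyn]) (by rwa [norm_div, div_lt_one hzn])).mul_left
      ‖q / (y * z)‖
  exact h.congr fun p => by
    rw [termNum_neg_succ hq0 (norm_pos_iff.1 hyn) (norm_pos_iff.1 hzn), norm_mul]

theorem summable_norm_termNonneg (hq0 : q ≠ 0) (hq1 : ‖q‖ < 1) (hy : ‖y‖ < 1) (hz : ‖z‖ < 1)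
    (hx : x ≠ 0) : Summable fun p => ‖termNonneg q x y z p‖ :=
  summable_norm_div_one_sub_mul_zpow (a := fun p : ℕ × ℕ => termNum q y z p.1 p.2) hq0 hq1
    (summable_norm_div_one_add_zpow _ _ (summable_norm_termNum hq1 hy hz)) hx

theorem summable_norm_termNeg (hq0 : q ≠ 0) (hq1 : ‖q‖ < 1) (hqy : ‖q‖ < ‖y‖)
    (hqz : ‖q‖ < ‖z‖) (hx : x ≠ 0) : Summable fun p => ‖termNeg q x y z p‖ :=
  summable_norm_div_one_sub_mul_zpow
    (a := fun p : ℕ × ℕ => termNum q y z (-((p.1 : ℤ) + 1)) (-((p.2 : ℤ) + 1))) hq0 hq1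
    (summable_norm_div_one_add_zpow _ _ (summable_norm_termNum_neg hq0 hq1 hqy hqz)) hx

/-- The exponent `-1` is never of the form `s + t` with `s`, `t` both nonnegative or both
negative. -/
theorem analyticAt_doubleSum (hq0 : q ≠ 0) (hqy : ‖q‖ < ‖y‖) (hy : ‖y‖ < 1) (hqz : ‖q‖ < ‖z‖)
    (hz : ‖z‖ < 1) (hx : x ≠ 0) (h : ∀ e : ℤ, e ≠ -1 → x * q ^ e ≠ 1) :
    AnalyticAt ℂ (fun w => doubleSum q w y z) x := by
  have hq1 := hqy.trans hy
  exact (analyticAt_tsum_div_one_sub_mul_zpow (a := fun p : ℕ × ℕ => termNum q y z p.1 p.2) hq0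
    hq1 (summable_norm_div_one_add_zpow _ _ (summable_norm_termNum hq1 hy hz)) hx
    fun _ _ => h _ (by lia)).sub (analyticAt_tsum_div_one_sub_mul_zpow
      (a := fun p : ℕ × ℕ => termNum q y z (-((p.1 : ℤ) + 1)) (-((p.2 : ℤ) + 1))) hq0 hq1
      (summable_norm_div_one_add_zpow _ _ (summable_norm_termNum_neg hq0 hq1 hqy hqz)) hx
      fun _ _ => h _ (by lia))

theorem hasSimplePoleAt_doubleSum (hq0 : q ≠ 0) (hqy : ‖q‖ < ‖y‖) (hy : ‖y‖ < 1)
    (hqz : ‖q‖ < ‖z‖) (hz : ‖z‖ < 1) : HasSimplePoleAt (fun w => doubleSum q w y z) (-1) 1 := by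
  have hq1 := hqy.trans hy
  have hpole := hasSimplePoleAt_tsum_div_one_sub_mul_zpow (x := 1)
    (a := fun p : ℕ × ℕ => termNum q y z p.1 p.2) (e := fun p => p.1 + p.2) (i₀ := (0, 0)) hq0 hq1
    (summable_norm_div_one_add_zpow _ _ (summable_norm_termNum hq1 hy hz)) (by simp) fun p hp => by
      rw [one_mul, zpow_eq_one_iff_of_norm_lt_one hq1] at hp
      ext <;> lia
  have hreg := analyticAt_tsum_div_one_sub_mul_zpow
    (a := fun p : ℕ × ℕ => termNum q y z (-((p.1 : ℤ) + 1)) (-((p.2 : ℤ) + 1)))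
    (e := fun p => -((p.1 : ℤ) + 1) + -((p.2 : ℤ) + 1)) hq0 hq1
    (summable_norm_div_one_add_zpow _ _ (summable_norm_termNum_neg hq0 hq1 hqy hqz)) one_ne_zero
    fun p _ => by
      rw [one_mul, Ne, zpow_eq_one_iff_of_norm_lt_one hq1]
      lia
  have hres : -1 * termNum q y z (0 : ℕ) (0 : ℕ) - 0 = -1 := by simp [termNum]
  rw [← hres]
  exact hpole.sub (hasSimplePoleAt_of_analyticAt hreg)

theorem tsum_termNum (hq1 : ‖q‖ < 1) (y : ℂ) (hz : ‖z‖ < 1) (m : ℕ) :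
    ∑' n : ℕ, termNum q y z m n = y ^ m / (1 - z * q ^ m) := by
  have hratio : ‖z * q ^ m‖ < 1 := by
    rw [norm_mul, norm_pow]
    exact (mul_le_of_le_one_right (norm_nonneg z) (pow_le_one₀ (norm_nonneg q) hq1.le)).trans_lt hz
  rw [div_eq_mul_inv, ← tsum_geometric_of_norm_lt_one hratio, ← tsum_mul_left]
  refine tsum_congr fun n => ?_
  rw [termNum_natCast, mul_pow, ← pow_mul]
  ring

theorem tsum_termNum_neg (hq0 : q ≠ 0) (hq1 : ‖q‖ < 1) (hy0 : y ≠ 0) (hqz : ‖q‖ < ‖z‖) (m : ℕ) :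
    ∑' n : ℕ, termNum q y z (-((m : ℤ) + 1)) (-((n : ℤ) + 1)) =
      -(y ^ (-((m : ℤ) + 1)) / (1 - z * q ^ (-((m : ℤ) + 1)))) := by
  have hzn := (norm_pos_iff.2 hq0).trans hqz
  have hz0 := norm_pos_iff.1 hzn
  have hden : z - q ^ (m + 1) ≠ 0 := sub_ne_zero.2 fun h => by
    rw [h, norm_pow] at hqz
    exact hqz.not_ge (pow_le_of_le_one (norm_nonneg q) hq1.le m.succ_ne_zero)
  have hden' : 1 - q / z * q ^ m = (z - q ^ (m + 1)) / z := by
    rw [sub_div, div_self hz0]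
    ring
  have hden'' : 1 - z * (q ^ (m + 1))⁻¹ = -(z - q ^ (m + 1)) / q ^ (m + 1) := by
    field_simp
    ring
  simp only [termNum_neg_succ hq0 hy0 hz0]
  rw [tsum_mul_left, tsum_termNum hq1 _ (by rwa [norm_div, div_lt_one hzn]), hden',
    ← Nat.cast_succ, zpow_neg, zpow_neg, zpow_natCast, zpow_natCast, Nat.succ_eq_add_one, hden'',
    div_pow, neg_div]
  generalize z - q ^ (m + 1) = d at hden
  field_simp
  ring

theorem tsum_termNum_sub (hq0 : q ≠ 0) (hqy : ‖q‖ < ‖y‖) (hy : ‖y‖ < 1) (hqz : ‖q‖ < ‖z‖)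
    (hz : ‖z‖ < 1) :
    ∑' p : ℕ × ℕ, termNum q y z p.1 p.2 -
      ∑' p : ℕ × ℕ, termNum q y z (-((p.1 : ℤ) + 1)) (-((p.2 : ℤ) + 1)) = kroneckerSum q y z := by
  have hq1 := hqy.trans hy
  have hqn := norm_pos_iff.2 hq0
  have hsum := (summable_norm_div_one_sub_mul_zpow (e := id) hq0 hq1
    (summable_norm_zpow_div_one_add hq0 hqy hy) (norm_pos_iff.1 (hqn.trans hqz))).of_norm
  rw [kroneckerSum, tsum_of_nat_of_neg_add_one (f := fun n : ℤ => y ^ n / (1 - z * q ^ n))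
      (hsum.comp_injective Nat.cast_injective)
      (hsum.comp_injective (i := fun n : ℕ => -((n : ℤ) + 1)) fun a b h => by simpa using h),
    (summable_norm_termNum hq1 hy hz).of_norm.tsum_prod,
    (summable_norm_termNum_neg hq0 hq1 hqy hqz).of_norm.tsum_prod]
  simp only [tsum_termNum hq1 y hz, tsum_termNum_neg hq0 hq1 (norm_pos_iff.1 (hqn.trans hqy)) hqz,
    zpow_natCast, tsum_neg, sub_neg_eq_add]

theorem tsum_prod_eq_tsum_succ_add {F : ℕ × ℕ → ℂ} (hF : Summable F) :
    ∑' p, F p = ∑' p : ℕ × ℕ, F (p.1 + 1, p.2 + 1) + ∑' s : ℕ, F (s, 0) + ∑' t : ℕ, F (0, t)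
      - F (0, 0) := by
  have hsucc : Summable fun p : ℕ × ℕ => F (p.1 + 1, p.2 + 1) :=
    hF.comp_injective (Nat.succ_injective.prodMap Nat.succ_injective)
  have hcol : Summable fun p : ℕ × ℕ => F (p.1, p.2 + 1) :=
    hF.comp_injective (Function.injective_id.prodMap Nat.succ_injective)
  have hrow (s : ℕ) : ∑' t, F (s, t) = F (s, 0) + ∑' t, F (s, t + 1) :=
    (hF.prod_factor s).tsum_eq_zero_add
  have hzero : Summable fun s => F (s, 0) := hF.comp_injective (Prod.mk_left_injective 0)
  rw [hF.tsum_prod, tsum_congr hrow, hzero.tsum_add hcol.prod,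
    hcol.prod.tsum_eq_zero_add, hsucc.tsum_prod, (hF.prod_factor 0).tsum_eq_zero_add]
  ring

theorem tsum_int_eq_tsum_nat_add_tsum_neg {f : ℤ → ℂ} (hf : Summable f) :
    ∑' n, f n = ∑' n : ℕ, f n + ∑' n : ℕ, f (-(n : ℤ)) - f 0 :=
  (HasSum.of_nat_of_neg (hf.comp_injective Nat.cast_injective).hasSum
    (hf.comp_injective (neg_injective.comp Nat.cast_injective)).hasSum).tsum_eq

theorem term_mul_sq (hq0 : q ≠ 0) (hy0 : y ≠ 0) (hz0 : z ≠ 0) {s t : ℤ}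
    (hx : x * q ^ (s + 1 + (t + 1)) ≠ 1) :
    term q (q ^ 2 * x) y z s t =
      termNum q y z s t + q / (y * z) * x * term q x y z (s + 1) (t + 1) := by
  have hmul : q ^ ((s + 1) * (t + 1)) = q ^ (s * t) * q ^ (s + t) * q := by
    rw [← zpow_add₀ hq0, ← zpow_add_one₀ hq0]
    ring_nf
  have hadd : q ^ (s + 1 + (t + 1)) = q ^ 2 * q ^ (s + t) := by
    rw [← zpow_natCast q 2, ← zpow_add₀ hq0]
    congr 1
    push_cast
    ring
  have hden : 1 - x * q ^ (s + 1 + (t + 1)) ≠ 0 := sub_ne_zero.2 hx.symm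
  rw [term, term, termNum, show q ^ 2 * x * q ^ (s + t) = x * q ^ (s + 1 + (t + 1)) by
    rw [hadd]; ring, ← sub_eq_iff_eq_add, ← mul_div_assoc, ← sub_div, div_eq_iff hden, hmul, hadd,
    zpow_add_one₀ hy0, zpow_add_one₀ hz0]
  field_simp

theorem tsum_termNonneg_mul_sq (hq0 : q ≠ 0) (hy0 : y ≠ 0) (hz0 : z ≠ 0) (hq1 : ‖q‖ < 1)
    (hy : ‖y‖ < 1) (hz : ‖z‖ < 1) (hx : x ≠ 0) (hθ : theta x q ≠ 0) :
    ∑' p, termNonneg q (q ^ 2 * x) y z p = ∑' p : ℕ × ℕ, termNum q y z p.1 p.2 +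
      q / (y * z) * x * ∑' p : ℕ × ℕ, termNonneg q x y z (p.1 + 1, p.2 + 1) := by
  have hshift : Summable fun p : ℕ × ℕ => termNonneg q x y z (p.1 + 1, p.2 + 1) :=
    (summable_norm_termNonneg hq0 hq1 hy hz hx).of_norm.comp_injective
      (Nat.succ_injective.prodMap Nat.succ_injective)
  rw [← tsum_mul_left, ← (summable_norm_termNum hq1 hy hz).of_norm.tsum_add (hshift.mul_left _)]
  refine tsum_congr fun p => ?_
  rw [termNonneg, termNonneg, term_mul_sq hq0 hy0 hz0 ((theta_ne_zero_iff hq0 hq1).1 hθ _),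
    Nat.cast_succ, Nat.cast_succ]

theorem termNeg_mul_sq (hq0 : q ≠ 0) (hq1 : ‖q‖ < 1) (hy0 : y ≠ 0) (hz0 : z ≠ 0)
    (hθ : theta x q ≠ 0) (p : ℕ × ℕ) :
    termNeg q (q ^ 2 * x) y z p = termNum q y z (-((p.1 : ℤ) + 1)) (-((p.2 : ℤ) + 1)) +
      q / (y * z) * x * term q x y z (-(p.1 : ℤ)) (-(p.2 : ℤ)) := by
  rw [termNeg, term_mul_sq hq0 hy0 hz0 ((theta_ne_zero_iff hq0 hq1).1 hθ _), neg_add,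
    neg_add, neg_add_cancel_right, neg_add_cancel_right]

theorem summable_term_neg (hq0 : q ≠ 0) (hq1 : ‖q‖ < 1) (hqy : ‖q‖ < ‖y‖) (hqz : ‖q‖ < ‖z‖)
    (hx : x ≠ 0) (hθ : theta x q ≠ 0) :
    Summable fun p : ℕ × ℕ => term q x y z (-(p.1 : ℤ)) (-(p.2 : ℤ)) := by
  have hy0 := norm_pos_iff.1 ((norm_pos_iff.2 hq0).trans hqy)
  have hz0 := norm_pos_iff.1 ((norm_pos_iff.2 hq0).trans hqz)
  have hcoeff : q / (y * z) * x ≠ 0 := mul_ne_zero (div_ne_zero hq0 (mul_ne_zero hy0 hz0)) hx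
  refine (summable_mul_left_iff hcoeff).1 (((summable_norm_termNeg hq0 hq1 hqy hqz
    (mul_ne_zero (pow_ne_zero 2 hq0) hx)).of_norm.sub
      (summable_norm_termNum_neg hq0 hq1 hqy hqz).of_norm).congr fun p => ?_)
  rw [termNeg_mul_sq hq0 hq1 hy0 hz0 hθ, add_sub_cancel_left]

theorem tsum_termNeg_mul_sq (hq0 : q ≠ 0) (hq1 : ‖q‖ < 1) (hqy : ‖q‖ < ‖y‖) (hqz : ‖q‖ < ‖z‖)
    (hx : x ≠ 0) (hθ : theta x q ≠ 0) :
    ∑' p, termNeg q (q ^ 2 * x) y z p =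
      ∑' p : ℕ × ℕ, termNum q y z (-((p.1 : ℤ) + 1)) (-((p.2 : ℤ) + 1)) +
        q / (y * z) * x * ∑' p : ℕ × ℕ, term q x y z (-(p.1 : ℤ)) (-(p.2 : ℤ)) := by
  rw [← tsum_mul_left, ← (summable_norm_termNum_neg hq0 hq1 hqy hqz).of_norm.tsum_add
    ((summable_term_neg hq0 hq1 hqy hqz hx hθ).mul_left _)]
  exact tsum_congr (termNeg_mul_sq hq0 hq1 (norm_pos_iff.1 ((norm_pos_iff.2 hq0).trans hqy))
    (norm_pos_iff.1 ((norm_pos_iff.2 hq0).trans hqz)) hθ)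

theorem doubleSum_sub_kroneckerSum (hq0 : q ≠ 0) (hqy : ‖q‖ < ‖y‖) (hy : ‖y‖ < 1)
    (hqz : ‖q‖ < ‖z‖) (hz : ‖z‖ < 1) (hx : x ≠ 0) (hθ : theta x q ≠ 0) :
    doubleSum q x y z - kroneckerSum q y x - kroneckerSum q z x =
      ∑' p : ℕ × ℕ, termNonneg q x y z (p.1 + 1, p.2 + 1) -
        ∑' p : ℕ × ℕ, term q x y z (-(p.1 : ℤ)) (-(p.2 : ℤ)) := by
  have hq1 := hqy.trans hy
  have hsum {w : ℂ} (hqw : ‖q‖ < ‖w‖) (hw : ‖w‖ < 1) :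
      Summable fun n : ℤ => w ^ n / (1 - x * q ^ n) :=
    (summable_norm_div_one_sub_mul_zpow (e := id) hq0 hq1
      (summable_norm_zpow_div_one_add hq0 hqw hw) hx).of_norm
  have hnonneg := tsum_prod_eq_tsum_succ_add (summable_norm_termNonneg hq0 hq1 hy hz hx).of_norm
  have hnonpos := tsum_prod_eq_tsum_succ_add (summable_term_neg hq0 hq1 hqy hqz hx hθ)
  have hkry := tsum_int_eq_tsum_nat_add_tsum_neg (hsum hqy hy)
  have hkrz := tsum_int_eq_tsum_nat_add_tsum_neg (hsum hqz hz)
  rw [doubleSum, kroneckerSum, kroneckerSum, hnonneg, hnonpos, hkry, hkrz]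
  simp only [termNonneg, termNeg, term, Nat.cast_succ, Nat.cast_zero, neg_zero, mul_zero, zero_mul,
    zpow_zero, add_zero, zero_add, mul_one, one_mul]
  ring

theorem doubleSum_mul_sq (hq0 : q ≠ 0) (hqy : ‖q‖ < ‖y‖) (hy : ‖y‖ < 1) (hqz : ‖q‖ < ‖z‖)
    (hz : ‖z‖ < 1) (hx : x ≠ 0) (hθ : theta x q ≠ 0) :
    doubleSum q (q ^ 2 * x) y z = kroneckerSum q y z +
      q / (y * z) * x * (doubleSum q x y z - kroneckerSum q y x - kroneckerSum q z x) := by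
  have hq1 := hqy.trans hy
  have hy0 := norm_pos_iff.1 ((norm_pos_iff.2 hq0).trans hqy)
  have hz0 := norm_pos_iff.1 ((norm_pos_iff.2 hq0).trans hqz)
  rw [doubleSum_sub_kroneckerSum hq0 hqy hy hqz hz hx hθ, doubleSum,
    tsum_termNonneg_mul_sq hq0 hy0 hz0 hq1 hy hz hx hθ,
    tsum_termNeg_mul_sq hq0 hq1 hqy hqz hx hθ, ← tsum_termNum_sub hq0 hqy hy hqz hz]
  ring

end DoubleSum

section LerchPart

variable {q a b c : ℂ}

theorem theta_mul_sq (hq0 : q ≠ 0) (hq1 : ‖q‖ < 1) (ha : a ≠ 0) :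
    theta (q ^ 2 * a) q = (q * a ^ 2)⁻¹ * theta a q := by
  rw [sq, mul_assoc, theta_mul hq0 hq1 (mul_ne_zero hq0 ha), theta_mul hq0 hq1 ha]
  field_simp

theorem hasSimplePoleAt_inv_theta_self (hq0 : q ≠ 0) (hq1 : ‖q‖ < 1) :
    HasSimplePoleAt (fun w => (theta w q)⁻¹) (q / qPoch q q ^ 2) q := by
  have hpole := (hasSimplePoleAt_inv_theta_const_mul hq1 (inv_ne_zero hq0)).analytic_mul
    (u := fun w => -(w / q)) (by fun_prop)
  rw [inv_inv] at hpole
  convert hpole.congr ?_ using 1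
  · field_simp
  · filter_upwards [(eventually_ne_nhds hq0).filter_mono nhdsWithin_le_nhds] with w hw
    have hmul := theta_mul hq0 hq1 (mul_ne_zero (inv_ne_zero hq0) hw)
    rw [mul_inv_cancel_left₀ hq0] at hmul
    rw [hmul, mul_inv]
    congr 1
    field_simp

/-- The coefficient of the Lerch-type sum in `Kronecker.lerchPart`. -/
def lerchCoeff (q a b : ℂ) : ℂ :=
  qPoch q q ^ 2 / qPoch (q ^ 2) (q ^ 2) * theta (a * b) (q ^ 2) / (theta a q * theta b q)

theorem lerchCoeff_comm (q a b : ℂ) : lerchCoeff q a b = lerchCoeff q b a := by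
  rw [lerchCoeff, lerchCoeff, mul_comm a, mul_comm (theta a q)]

/-- `Kronecker.lerchPart` with the factor `theta a q` of its denominator cleared; it is analytic
in `a` on the punctured plane. -/
def lerchNum (q a b c : ℂ) : ℂ :=
  qPoch q q ^ 2 / qPoch (q ^ 2) (q ^ 2) * theta (a * b) (q ^ 2) / theta b q * lerchSum q (a * b) c

theorem lerchPart_eq_lerchCoeff_mul (q a b c : ℂ) :
    lerchPart q a b c = lerchCoeff q a b * lerchSum q (a * b) c := by
  simp only [lerchPart, lerchCoeff, lerchSum, qPochs, theta, List.map_cons, List.map_nil,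
    List.prod_cons, List.prod_nil, mul_one]
  ring

theorem lerchPart_eq_lerchNum_mul (q a b c : ℂ) :
    lerchPart q a b c = lerchNum q a b c * (theta a q)⁻¹ := by
  rw [lerchPart_eq_lerchCoeff_mul, lerchCoeff, lerchNum]
  ring

theorem lerchCoeff_mul_thetaSum (hq0 : q ≠ 0) (hq1 : ‖q‖ < 1) (ha : a ≠ 0) (hb : b ≠ 0) :
    lerchCoeff q a b * thetaSum q (a * b) =
      qPoch q q ^ 2 * theta (a * b) q / (theta a q * theta b q) := by
  have hP := qPoch_self_ne_zero (norm_sq_lt_one hq1)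
  rw [lerchCoeff, thetaSum_eq_qPoch_mul_theta hq0 hq1 (mul_ne_zero ha hb),
    theta_sq (a * b) hq0 hq1]
  field_simp

theorem kroneckerSum_eq_lerchCoeff_mul (hq0 : q ≠ 0) (hqb : ‖q‖ < ‖b‖) (hb : ‖b‖ < 1)
    (ha : a ≠ 0) (hθ : theta a q ≠ 0) :
    kroneckerSum q b a = lerchCoeff q a b * thetaSum q (a * b) := by
  rw [kroneckerSum_eq_theta_div hq0 hqb hb ha hθ, lerchCoeff_mul_thetaSum hq0 (hqb.trans hb) ha
    (norm_pos_iff.1 ((norm_nonneg q).trans_lt hqb)), mul_comm b]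

theorem lerchCoeff_mul_sq (hq0 : q ≠ 0) (hq1 : ‖q‖ < 1) (ha : a ≠ 0) (hb : b ≠ 0) :
    lerchCoeff q (q ^ 2 * a) b = -(q / b * a) * lerchCoeff q a b := by
  rw [lerchCoeff, lerchCoeff, theta_mul_sq hq0 hq1 ha, mul_assoc (q ^ 2),
    theta_mul (pow_ne_zero 2 hq0) (norm_sq_lt_one hq1) (mul_ne_zero ha hb), mul_assoc _ (theta a q),
    div_mul_eq_div_div_swap]
  field_simp

theorem lerchPart_mul_sq_left (hq0 : q ≠ 0) (hq1 : ‖q‖ < 1) (ha : a ≠ 0) (hb : b ≠ 0)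
    (hc : c ≠ 0) (hθ : theta (-c) (q ^ 2) ≠ 0) :
    lerchPart q (q ^ 2 * a) b c =
      q / (b * c) * a * (lerchPart q a b c - lerchCoeff q a b * thetaSum q (a * b)) := by
  rw [lerchPart_eq_lerchCoeff_mul, lerchPart_eq_lerchCoeff_mul, lerchCoeff_mul_sq hq0 hq1 ha hb,
    mul_assoc (q ^ 2), lerchSum_mul_left hq0 hq1 hc hθ]
  field_simp
  ring

theorem lerchPart_mul_sq_right (hq0 : q ≠ 0) (hq1 : ‖q‖ < 1) (ha : a ≠ 0) (hb : b ≠ 0)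
    (hc : c ≠ 0) (hθ : theta (-c) (q ^ 2) ≠ 0) :
    lerchPart q a b (q ^ 2 * c) =
      lerchCoeff q a b * thetaSum q (a * b) + q / (a * b) * c * lerchPart q a b c := by
  rw [lerchPart_eq_lerchCoeff_mul, lerchPart_eq_lerchCoeff_mul,
    lerchSum_mul_right hq0 hq1 (mul_ne_zero ha hb) hc hθ]
  ring

theorem analyticAt_lerchPart_right (hq0 : q ≠ 0) (hq1 : ‖q‖ < 1) (a b : ℂ) (hc : c ≠ 0)
    (hθ : theta (-c) (q ^ 2) ≠ 0) : AnalyticAt ℂ (fun w => lerchPart q a b w) c := by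
  simp only [lerchPart_eq_lerchCoeff_mul]
  exact analyticAt_const.mul (analyticAt_lerchSum_right hq0 hq1 _ hc hθ)

theorem hasSimplePoleAt_lerchPart_right (hq0 : q ≠ 0) (hq1 : ‖q‖ < 1) (a b : ℂ) :
    HasSimplePoleAt (fun w => lerchPart q a b w) (lerchCoeff q a b) (-1) := by
  simpa only [lerchPart_eq_lerchCoeff_mul, mul_one] using
    (hasSimplePoleAt_lerchSum_right hq0 hq1 (a * b)).const_mul (lerchCoeff q a b)

theorem analyticAt_lerchNum (hq0 : q ≠ 0) (hq1 : ‖q‖ < 1) (ha : a ≠ 0) (hb : b ≠ 0) (hc : c ≠ 0)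
    (hθ : theta (-c) (q ^ 2) ≠ 0) : AnalyticAt ℂ (fun w => lerchNum q w b c) a := by
  have hab := mul_ne_zero ha hb
  have hθan := analyticAt_theta_comp (f := fun w => w * b) (norm_sq_lt_one hq1) (by fun_prop) hab
  have hLan := (analyticAt_lerchSum_left hq0 hq1 hab hc hθ).fun_comp (f := fun w => w * b)
    (by fun_prop)
  unfold lerchNum
  fun_prop

theorem analyticAt_lerchPart_left (hq0 : q ≠ 0) (hq1 : ‖q‖ < 1) (ha : a ≠ 0) (hb : b ≠ 0)
    (hc : c ≠ 0) (hθ : theta (-c) (q ^ 2) ≠ 0) (hθa : theta a q ≠ 0) :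
    AnalyticAt ℂ (fun w => lerchPart q w b c) a := by
  simp only [lerchPart_eq_lerchNum_mul]
  exact (analyticAt_lerchNum hq0 hq1 ha hb hc hθ).mul
    ((analyticAt_theta_comp hq1 analyticAt_id ha).inv hθa)

theorem hasSimplePoleAt_lerchPart_one (hq0 : q ≠ 0) (hq1 : ‖q‖ < 1) (hb : b ≠ 0) (hc : c ≠ 0)
    (hθ : theta (-c) (q ^ 2) ≠ 0) (hθb : theta b q ≠ 0) :
    HasSimplePoleAt (fun w => lerchPart q w b c) (-appellLerch q b c) 1 := by
  have hQ := qPoch_self_ne_zero hq1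
  rw [theta_sq b hq0 hq1] at hθb
  have hθb₁ := left_ne_zero_of_mul hθb
  simp only [lerchPart_eq_lerchNum_mul]
  convert (hasSimplePoleAt_inv_theta hq1).analytic_mul
    (analyticAt_lerchNum hq0 hq1 one_ne_zero hb hc hθ) using 1
  rw [lerchNum, appellLerch, thetaSum_eq_qPoch_mul_theta hq0 hq1 hb, one_mul, theta_sq b hq0 hq1]
  field_simp

theorem hasSimplePoleAt_lerchPart_self (hq0 : q ≠ 0) (hq1 : ‖q‖ < 1) (hb : b ≠ 0) (hc : c ≠ 0)
    (hθ : theta (-c) (q ^ 2) ≠ 0) (hθb : theta b q ≠ 0) :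
    HasSimplePoleAt (fun w => lerchPart q w b c) (-(q / b) * appellLerch q (q * b) c) q := by
  have hQ := qPoch_self_ne_zero hq1
  have hqb := mul_ne_zero hq0 hb
  rw [theta_sq b hq0 hq1] at hθb
  have hθb₂ := right_ne_zero_of_mul hθb
  simp only [lerchPart_eq_lerchNum_mul]
  convert (hasSimplePoleAt_inv_theta_self hq0 hq1).analytic_mul
    (analyticAt_lerchNum hq0 hq1 hq0 hb hc hθ) using 1
  rw [lerchNum, appellLerch, thetaSum_eq_qPoch_mul_theta hq0 hq1 hqb, ← mul_assoc, ← sq,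
    theta_mul (pow_ne_zero 2 hq0) (norm_sq_lt_one hq1) hb, theta_sq b hq0 hq1]
  field_simp

end LerchPart

section ThetaPart

variable {q x y z : ℂ}

/-- `Kronecker.thetaPart` with the factors of its denominator that vanish for some `x` cleared. -/
def thetaNum (q x y z : ℂ) : ℂ :=
  qPoch (q ^ 2) (q ^ 2) ^ 3 *
    (theta (x * y) (q ^ 2) * theta (x * z) (q ^ 2) * theta (y * z) (q ^ 2)) /
      (theta y q * theta z q * (theta (-y) (q ^ 2) * theta (-z) (q ^ 2)))

theorem thetaPart_eq_thetaNum_mul (q x y z : ℂ) :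
    thetaPart q x y z = thetaNum q x y z * ((theta x q)⁻¹ * (theta (-1 * x) (q ^ 2))⁻¹) := by
  simp only [thetaPart, thetaNum, qPochs, theta, List.map_cons, List.map_nil, List.prod_cons,
    List.prod_nil, mul_one, neg_one_mul, div_neg, neg_div]
  ring

theorem thetaPart_mul_sq (hq0 : q ≠ 0) (hq1 : ‖q‖ < 1) (hx : x ≠ 0) (hy : y ≠ 0) (hz : z ≠ 0) :
    thetaPart q (q ^ 2 * x) y z = q / (y * z) * x * thetaPart q x y z := by
  have hp0 := pow_ne_zero 2 hq0
  have hp1 := norm_sq_lt_one hq1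
  rw [thetaPart_eq_thetaNum_mul, thetaPart_eq_thetaNum_mul, thetaNum, thetaNum,
    theta_mul_sq hq0 hq1 hx, mul_assoc (q ^ 2), mul_assoc (q ^ 2), mul_left_comm (-1),
    theta_mul hp0 hp1 (mul_ne_zero hx hy), theta_mul hp0 hp1 (mul_ne_zero hx hz),
    theta_mul hp0 hp1 (mul_ne_zero (neg_ne_zero.2 one_ne_zero) hx), mul_inv _ (theta x q),
    mul_inv _ (theta (-1 * x) (q ^ 2))]
  field_simp

theorem analyticAt_thetaNum (hq1 : ‖q‖ < 1) (hx : x ≠ 0) (hy : y ≠ 0) (hz : z ≠ 0) :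
    AnalyticAt ℂ (fun w => thetaNum q w y z) x := by
  have hθan {b : ℂ} (hb : b ≠ 0) : AnalyticAt ℂ (fun w => theta (w * b) (q ^ 2)) x :=
    analyticAt_theta_comp (f := fun w => w * b) (norm_sq_lt_one hq1) (by fun_prop)
      (mul_ne_zero hx hb)
  exact (analyticAt_const.mul (((hθan hy).mul (hθan hz)).mul analyticAt_const)).div_const

theorem analyticAt_thetaPart (hq1 : ‖q‖ < 1) (hx : x ≠ 0) (hy : y ≠ 0) (hz : z ≠ 0)
    (hθ : theta x q ≠ 0) (hθ' : theta (-x) (q ^ 2) ≠ 0) :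
    AnalyticAt ℂ (fun w => thetaPart q w y z) x := by
  simp only [thetaPart_eq_thetaNum_mul]
  exact (analyticAt_thetaNum hq1 hx hy hz).mul
    (((analyticAt_theta_comp hq1 analyticAt_id hx).inv hθ).mul
      (analyticAt_inv_theta_const_mul (norm_sq_lt_one hq1) (neg_ne_zero.2 one_ne_zero) hx
        (by rwa [neg_one_mul])))

theorem hasSimplePoleAt_thetaPart_of_inv_theta {r : ℂ} (hq1 : ‖q‖ < 1) (hx : x ≠ 0) (hy : y ≠ 0)
    (hz : z ≠ 0) (hθ : theta (-x) (q ^ 2) ≠ 0)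
    (hpole : HasSimplePoleAt (fun w => (theta w q)⁻¹) r x) :
    HasSimplePoleAt (fun w => thetaPart q w y z)
      (thetaNum q x y z * ((theta (-x) (q ^ 2))⁻¹ * r)) x := by
  rw [← neg_one_mul] at hθ ⊢
  simp only [thetaPart_eq_thetaNum_mul, mul_comm (theta _ q)⁻¹]
  exact (hpole.analytic_mul (analyticAt_inv_theta_const_mul (norm_sq_lt_one hq1)
    (neg_ne_zero.2 one_ne_zero) hx hθ)).analytic_mul (analyticAt_thetaNum hq1 hx hy hz)

theorem theta_neg_one_mul_theta_neg_mul_sq (hq0 : q ≠ 0) (hq1 : ‖q‖ < 1) :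
    theta (-1) (q ^ 2) * theta (-q) (q ^ 2) * qPoch q q ^ 2 = 2 * qPoch (q ^ 2) (q ^ 2) ^ 2 := by
  rw [← theta_neg_one_mul_sq hq1, theta_sq _ hq0 hq1, mul_neg_one]

theorem hasSimplePoleAt_thetaPart_one (hq0 : q ≠ 0) (hq1 : ‖q‖ < 1) (hy : y ≠ 0) (hz : z ≠ 0)
    (hθy : theta y (q ^ 2) ≠ 0) (hθz : theta z (q ^ 2) ≠ 0) :
    HasSimplePoleAt (fun w => thetaPart q w y z)
      (-(qPoch (q ^ 2) (q ^ 2) * (theta (y * z) (q ^ 2) * theta (-q) (q ^ 2)) /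
        (theta (q * y) (q ^ 2) * theta (q * z) (q ^ 2) *
          (theta (-y) (q ^ 2) * theta (-z) (q ^ 2)))) / 2) 1 := by
  have hQ := qPoch_self_ne_zero hq1
  have hm := theta_neg_one_ne_zero (pow_ne_zero 2 hq0) (norm_sq_lt_one hq1)
  convert hasSimplePoleAt_thetaPart_of_inv_theta hq1 one_ne_zero hy hz hm
    (hasSimplePoleAt_inv_theta hq1) using 1
  rw [thetaNum, one_mul, one_mul, theta_sq y hq0 hq1, theta_sq z hq0 hq1]
  field_simp
  linear_combination -(qPoch (q ^ 2) (q ^ 2) * theta (y * z) (q ^ 2) / (theta (q * y) (q ^ 2) *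
    theta (q * z) (q ^ 2) * theta (-y) (q ^ 2) * theta (-z) (q ^ 2))) *
      theta_neg_one_mul_theta_neg_mul_sq hq0 hq1

theorem theta_neg_self_sq_ne_zero (hq0 : q ≠ 0) (hq1 : ‖q‖ < 1) : theta (-q) (q ^ 2) ≠ 0 := by
  have h := theta_neg_one_ne_zero hq0 hq1
  rw [theta_sq _ hq0 hq1, mul_neg_one] at h
  exact right_ne_zero_of_mul h

theorem hasSimplePoleAt_thetaPart_self (hq0 : q ≠ 0) (hq1 : ‖q‖ < 1) (hy : y ≠ 0) (hz : z ≠ 0)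
    (hθy : theta (q * y) (q ^ 2) ≠ 0) (hθz : theta (q * z) (q ^ 2) ≠ 0) :
    HasSimplePoleAt (fun w => thetaPart q w y z)
      (q * (qPoch (q ^ 2) (q ^ 2) * (theta (y * z) (q ^ 2) * theta (-1) (q ^ 2)) /
        (theta y (q ^ 2) * theta z (q ^ 2) *
          (theta (-y) (q ^ 2) * theta (-z) (q ^ 2)))) / 2) q := by
  have hQ := qPoch_self_ne_zero hq1
  have hP := qPoch_self_ne_zero (norm_sq_lt_one hq1)
  have hm := theta_neg_self_sq_ne_zero hq0 hq1
  convert hasSimplePoleAt_thetaPart_of_inv_theta hq1 hq0 hy hz hm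
    (hasSimplePoleAt_inv_theta_self hq0 hq1) using 1
  rw [thetaNum, theta_sq y hq0 hq1, theta_sq z hq0 hq1]
  field_simp
  linear_combination theta (y * z) (q ^ 2) / (theta y (q ^ 2) * theta z (q ^ 2) *
    theta (-y) (q ^ 2) * theta (-z) (q ^ 2)) * theta_neg_one_mul_theta_neg_mul_sq hq0 hq1

theorem hasSimplePoleAt_thetaPart_neg_one (hq0 : q ≠ 0) (hq1 : ‖q‖ < 1) (hy : y ≠ 0) (hz : z ≠ 0)
    (hθy : theta (-y) (q ^ 2) ≠ 0) (hθz : theta (-z) (q ^ 2) ≠ 0) :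
    HasSimplePoleAt (fun w => thetaPart q w y z) (lerchCoeff q y z / 2) (-1) := by
  have hP := qPoch_self_ne_zero (norm_sq_lt_one hq1)
  have hm := theta_neg_one_ne_zero hq0 hq1
  have hne : (-1 : ℂ) ≠ 0 := neg_ne_zero.2 one_ne_zero
  have hpole := hasSimplePoleAt_inv_theta_const_mul (norm_sq_lt_one hq1) hne
  rw [inv_neg_one] at hpole
  have hinv : AnalyticAt ℂ (fun w => (theta w q)⁻¹) (-1) :=
    (analyticAt_theta_comp hq1 analyticAt_id hne).inv hm
  simp only [thetaPart_eq_thetaNum_mul]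
  convert (hpole.analytic_mul hinv).analytic_mul (analyticAt_thetaNum hq1 hne hy hz) using 1
  rw [lerchCoeff, thetaNum, neg_one_mul, neg_one_mul]
  field_simp
  linear_combination theta (y * z) (q ^ 2) / (theta y q * theta z q) * theta_neg_one_mul_sq hq1

end ThetaPart

section ClosedForm

variable {q x y z : ℂ}

theorem closedForm_mul_sq (hq0 : q ≠ 0) (hq1 : ‖q‖ < 1) (hx : x ≠ 0) (hy : y ≠ 0) (hz : z ≠ 0)
    (hθx : theta (-x) (q ^ 2) ≠ 0) (hθy : theta (-y) (q ^ 2) ≠ 0)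
    (hθz : theta (-z) (q ^ 2) ≠ 0) :
    closedForm q (q ^ 2 * x) y z = lerchCoeff q y z * thetaSum q (y * z) + q / (y * z) * x *
      (closedForm q x y z - lerchCoeff q x y * thetaSum q (x * y) -
        lerchCoeff q x z * thetaSum q (x * z)) := by
  rw [closedForm, closedForm, lerchPart_mul_sq_right hq0 hq1 hy hz hx hθx,
    lerchPart_mul_sq_left hq0 hq1 hx hy hz hθz, lerchPart_mul_sq_left hq0 hq1 hx hz hy hθy,
    thetaPart_mul_sq hq0 hq1 hx hy hz, mul_comm z y]
  ring

theorem analyticAt_closedForm (hq0 : q ≠ 0) (hq1 : ‖q‖ < 1) (hx : x ≠ 0) (hy : y ≠ 0)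
    (hz : z ≠ 0) (hθy : theta (-y) (q ^ 2) ≠ 0) (hθz : theta (-z) (q ^ 2) ≠ 0)
    (hθ : theta x q ≠ 0) (hθx : theta (-x) (q ^ 2) ≠ 0) :
    AnalyticAt ℂ (fun w => closedForm q w y z) x :=
  (((analyticAt_lerchPart_right hq0 hq1 y z hx hθx).add
    (analyticAt_lerchPart_left hq0 hq1 hx hy hz hθz hθ)).sub
      (analyticAt_const.mul (analyticAt_thetaPart hq1 hx hy hz hθ hθx))).add
    (analyticAt_lerchPart_left hq0 hq1 hx hz hy hθy hθ)

theorem hasSimplePoleAt_closedForm {r₁ r₂ r₃ r₄ : ℂ}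
    (h₁ : HasSimplePoleAt (fun w => lerchPart q y z w) r₁ x)
    (h₂ : HasSimplePoleAt (fun w => lerchPart q w y z) r₂ x)
    (h₃ : HasSimplePoleAt (fun w => thetaPart q w y z) r₃ x)
    (h₄ : HasSimplePoleAt (fun w => lerchPart q w z y) r₄ x) :
    HasSimplePoleAt (fun w => closedForm q w y z) (r₁ + r₂ - 2 * r₃ + r₄) x :=
  ((h₁.add h₂).sub (h₃.const_mul 2)).add h₄

theorem theta_sq_ne_zero_of_norm_lt (hq0 : q ≠ 0) (hqy : ‖q‖ < ‖y‖) (hy : ‖y‖ < 1) :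
    theta y (q ^ 2) ≠ 0 ∧ theta (q * y) (q ^ 2) ≠ 0 := by
  rw [← mul_ne_zero_iff, ← theta_sq y hq0 (hqy.trans hy)]
  exact theta_ne_zero_of_norm_lt hq0 hqy hy

theorem theta_neg_sq_ne_zero_of_norm_lt (hq0 : q ≠ 0) (hqy : ‖q‖ < ‖y‖) (hy : ‖y‖ < 1) :
    theta (-y) (q ^ 2) ≠ 0 :=
  (theta_sq_ne_zero_of_norm_lt hq0 (by rwa [norm_neg]) (by rwa [norm_neg])).1

theorem theta_mul_sq_ne_zero_of_norm_lt (hq0 : q ≠ 0) (hqy : ‖q‖ < ‖y‖) (hy : ‖y‖ < 1)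
    (hqz : ‖q‖ < ‖z‖) (hz : ‖z‖ < 1) : theta (y * z) (q ^ 2) ≠ 0 := by
  refine theta_ne_zero_of_norm_lt (pow_ne_zero 2 hq0) ?_ ?_
  · rw [norm_pow, norm_mul, sq]
    exact mul_lt_mul'' hqy hqz (norm_nonneg q) (norm_nonneg q)
  · rw [norm_mul]
    exact mul_lt_one_of_nonneg_of_lt_one_left (norm_nonneg y) hy hz.le

theorem hasSimplePoleAt_closedForm_one (hq0 : q ≠ 0) (hqy : ‖q‖ < ‖y‖) (hy : ‖y‖ < 1)
    (hqz : ‖q‖ < ‖z‖) (hz : ‖z‖ < 1) :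
    HasSimplePoleAt (fun w => closedForm q w y z) (-1) 1 := by
  have hq1 := hqy.trans hy
  have hy0 := norm_pos_iff.1 ((norm_nonneg q).trans_lt hqy)
  have hz0 := norm_pos_iff.1 ((norm_nonneg q).trans_lt hqz)
  obtain ⟨hθy, hθqy⟩ := theta_sq_ne_zero_of_norm_lt hq0 hqy hy
  obtain ⟨hθz, hθqz⟩ := theta_sq_ne_zero_of_norm_lt hq0 hqz hz
  have hθy' := theta_neg_sq_ne_zero_of_norm_lt hq0 hqy hy
  have hθz' := theta_neg_sq_ne_zero_of_norm_lt hq0 hqz hz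
  convert hasSimplePoleAt_closedForm
    (hasSimplePoleAt_of_analyticAt (analyticAt_lerchPart_right hq0 hq1 y z one_ne_zero
      (theta_neg_one_ne_zero (pow_ne_zero 2 hq0) (norm_sq_lt_one hq1))))
    (hasSimplePoleAt_lerchPart_one hq0 hq1 hy0 hz0 hθz' (theta_ne_zero_of_norm_lt hq0 hqy hy))
    (hasSimplePoleAt_thetaPart_one hq0 hq1 hy0 hz0 hθy hθz)
    (hasSimplePoleAt_lerchPart_one hq0 hq1 hz0 hy0 hθy' (theta_ne_zero_of_norm_lt hq0 hqz hz))
    using 1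
  linear_combination appellLerch_add_swap hq0 hq1 hy0 hz0
    (theta_mul_sq_ne_zero_of_norm_lt hq0 hqy hy hqz hz) hθqy hθqz hθy' hθz'

theorem hasSimplePoleAt_closedForm_self (hq0 : q ≠ 0) (hqy : ‖q‖ < ‖y‖) (hy : ‖y‖ < 1)
    (hqz : ‖q‖ < ‖z‖) (hz : ‖z‖ < 1) :
    HasSimplePoleAt (fun w => closedForm q w y z) 0 q := by
  have hq1 := hqy.trans hy
  have hy0 := norm_pos_iff.1 ((norm_nonneg q).trans_lt hqy)
  have hz0 := norm_pos_iff.1 ((norm_nonneg q).trans_lt hqz)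
  obtain ⟨hθy, hθqy⟩ := theta_sq_ne_zero_of_norm_lt hq0 hqy hy
  obtain ⟨hθz, hθqz⟩ := theta_sq_ne_zero_of_norm_lt hq0 hqz hz
  have hθy' := theta_neg_sq_ne_zero_of_norm_lt hq0 hqy hy
  have hθz' := theta_neg_sq_ne_zero_of_norm_lt hq0 hqz hz
  convert hasSimplePoleAt_closedForm
    (hasSimplePoleAt_of_analyticAt (analyticAt_lerchPart_right hq0 hq1 y z hq0
      (theta_neg_self_sq_ne_zero hq0 hq1)))
    (hasSimplePoleAt_lerchPart_self hq0 hq1 hy0 hz0 hθz' (theta_ne_zero_of_norm_lt hq0 hqy hy))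
    (hasSimplePoleAt_thetaPart_self hq0 hq1 hy0 hz0 hθqy hθqz)
    (hasSimplePoleAt_lerchPart_self hq0 hq1 hz0 hy0 hθy' (theta_ne_zero_of_norm_lt hq0 hqz hz))
    using 1
  have hswap := mul_appellLerch_add_swap hq0 hq1 hy0 hz0
    (theta_mul_sq_ne_zero_of_norm_lt hq0 hqy hy hqz hz) hθy hθz hθy' hθz'
  generalize appellLerch q (q * y) z = A at hswap ⊢
  generalize appellLerch q (q * z) y = B at hswap ⊢
  generalize qPoch (q ^ 2) (q ^ 2) * _ / _ = T at hswap ⊢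
  field_simp
  linear_combination q * hswap

theorem hasSimplePoleAt_closedForm_neg_one (hq0 : q ≠ 0) (hq1 : ‖q‖ < 1) (hy : y ≠ 0)
    (hz : z ≠ 0) (hθy : theta (-y) (q ^ 2) ≠ 0) (hθz : theta (-z) (q ^ 2) ≠ 0) :
    HasSimplePoleAt (fun w => closedForm q w y z) 0 (-1) := by
  have hne : (-1 : ℂ) ≠ 0 := neg_ne_zero.2 one_ne_zero
  have hθ := theta_neg_one_ne_zero hq0 hq1
  convert hasSimplePoleAt_closedForm (hasSimplePoleAt_lerchPart_right hq0 hq1 y z)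
    (hasSimplePoleAt_of_analyticAt (analyticAt_lerchPart_left hq0 hq1 hne hy hz hθz hθ))
    (hasSimplePoleAt_thetaPart_neg_one hq0 hq1 hy hz hθy hθz)
    (hasSimplePoleAt_of_analyticAt (analyticAt_lerchPart_left hq0 hq1 hne hz hy hθy hθ)) using 1
  ring

theorem exists_eq_sq_zpow_mul_of_theta_eq_zero (hq0 : q ≠ 0) (hq1 : ‖q‖ < 1)
    (h : theta x q = 0) : ∃ b ∈ ({1, q} : Set ℂ), ∃ n : ℤ, x = (q ^ 2) ^ n * b := by
  have hp0 := pow_ne_zero 2 hq0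
  rw [theta_sq x hq0 hq1, mul_eq_zero, theta_eq_zero_iff hp0 (norm_sq_lt_one hq1),
    theta_eq_zero_iff hp0 (norm_sq_lt_one hq1)] at h
  obtain ⟨n, rfl⟩ | ⟨n, hn⟩ := h
  · exact ⟨1, by simp, n, (mul_one _).symm⟩
  · refine ⟨q, by simp, n - 1, mul_left_cancel₀ hq0 ?_⟩
    rw [hn, zpow_sub_one₀ hp0]
    field_simp

theorem doubleSum_sub_closedForm_mul_sq (hq0 : q ≠ 0) (hqy : ‖q‖ < ‖y‖) (hy : ‖y‖ < 1)
    (hqz : ‖q‖ < ‖z‖) (hz : ‖z‖ < 1) (hx : x ≠ 0) (hθ : theta x q ≠ 0)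
    (hθx : theta (-x) (q ^ 2) ≠ 0) :
    doubleSum q (q ^ 2 * x) y z - closedForm q (q ^ 2 * x) y z =
      q / (y * z) * x * (doubleSum q x y z - closedForm q x y z) := by
  have hq1 := hqy.trans hy
  have hy0 := norm_pos_iff.1 ((norm_nonneg q).trans_lt hqy)
  have hz0 := norm_pos_iff.1 ((norm_nonneg q).trans_lt hqz)
  rw [doubleSum_mul_sq hq0 hqy hy hqz hz hx hθ, closedForm_mul_sq hq0 hq1 hx hy0 hz0 hθx
      (theta_neg_sq_ne_zero_of_norm_lt hq0 hqy hy) (theta_neg_sq_ne_zero_of_norm_lt hq0 hqz hz),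
    kroneckerSum_eq_lerchCoeff_mul hq0 hqy hy hx hθ,
    kroneckerSum_eq_lerchCoeff_mul hq0 hqz hz hx hθ, kroneckerSum_eq_lerchCoeff_mul hq0 hqy hy hz0
      (theta_ne_zero_of_norm_lt hq0 hqz hz), lerchCoeff_comm q z y, mul_comm z y]
  ring

theorem analyticAt_doubleSum_sub_closedForm (hq0 : q ≠ 0) (hqy : ‖q‖ < ‖y‖) (hy : ‖y‖ < 1)
    (hqz : ‖q‖ < ‖z‖) (hz : ‖z‖ < 1) (hx : x ≠ 0) (hθ : theta x q ≠ 0)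
    (hθx : theta (-x) (q ^ 2) ≠ 0) :
    AnalyticAt ℂ (fun w => doubleSum q w y z - closedForm q w y z) x := by
  have hq1 := hqy.trans hy
  have hy0 := norm_pos_iff.1 ((norm_nonneg q).trans_lt hqy)
  have hz0 := norm_pos_iff.1 ((norm_nonneg q).trans_lt hqz)
  exact (analyticAt_doubleSum hq0 hqy hy hqz hz hx fun e _ =>
    (theta_ne_zero_iff hq0 hq1).1 hθ e).sub (analyticAt_closedForm hq0 hq1 hx hy0 hz0
      (theta_neg_sq_ne_zero_of_norm_lt hq0 hqy hy) (theta_neg_sq_ne_zero_of_norm_lt hq0 hqz hz)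
      hθ hθx)

theorem hasSimplePoleAt_doubleSum_sub_closedForm (hq0 : q ≠ 0) (hqy : ‖q‖ < ‖y‖) (hy : ‖y‖ < 1)
    (hqz : ‖q‖ < ‖z‖) (hz : ‖z‖ < 1) (hx : x ∈ ({1, q, -1} : Set ℂ)) :
    HasSimplePoleAt (fun w => doubleSum q w y z - closedForm q w y z) 0 x := by
  have hq1 := hqy.trans hy
  rcases hx with h | h | h <;> rw [h]
  · simpa using (hasSimplePoleAt_doubleSum hq0 hqy hy hqz hz).sub
      (hasSimplePoleAt_closedForm_one hq0 hqy hy hqz hz)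
  · simpa using (hasSimplePoleAt_of_analyticAt (analyticAt_doubleSum hq0 hqy hy hqz hz hq0
      fun e he => by
        rw [← zpow_one_add₀ hq0, Ne, zpow_eq_one_iff_of_norm_lt_one hq1]
        lia)).sub (hasSimplePoleAt_closedForm_self hq0 hqy hy hqz hz)
  · simpa using (hasSimplePoleAt_of_analyticAt (analyticAt_doubleSum hq0 hqy hy hqz hz
      (neg_ne_zero.2 one_ne_zero) fun e _ =>
        (theta_ne_zero_iff hq0 hq1).1 (theta_neg_one_ne_zero hq0 hq1) e)).sub
      (hasSimplePoleAt_closedForm_neg_one hq0 hq1 (norm_pos_iff.1 ((norm_nonneg q).trans_lt hqy))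
        (norm_pos_iff.1 ((norm_nonneg q).trans_lt hqz)) (theta_neg_sq_ne_zero_of_norm_lt hq0 hqy hy)
        (theta_neg_sq_ne_zero_of_norm_lt hq0 hqz hz))

theorem doubleSum_eq_closedForm (hq0 : q ≠ 0) (hqy : ‖q‖ < ‖y‖) (hy : ‖y‖ < 1)
    (hqz : ‖q‖ < ‖z‖) (hz : ‖z‖ < 1) (hx : x ≠ 0) (hθ : theta x q ≠ 0)
    (hθx : theta (-x) (q ^ 2) ≠ 0) : doubleSum q x y z = closedForm q x y z := by
  have hq1 := hqy.trans hy
  have hy0 := norm_pos_iff.1 ((norm_nonneg q).trans_lt hqy)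
  have hz0 := norm_pos_iff.1 ((norm_nonneg q).trans_lt hqz)
  have hp0 := pow_ne_zero 2 hq0
  have hp1 := norm_sq_lt_one hq1
  refine sub_eq_zero.1 (eq_zero_of_quasiperiodic (x := x) (S := {1, q, -1})
    (g := fun w => doubleSum q w y z - closedForm q w y z) (φ := fun w => q / (y * z) * w) hp0 hp1
    (fun b => hasSimplePoleAt_doubleSum_sub_closedForm hq0 hqy hy hqz hz) (fun a ha => ?_)
    (fun _ => by fun_prop)
    (fun w hw => mul_ne_zero (div_ne_zero hq0 (mul_ne_zero hy0 hz0)) hw) (by simp)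
    (fun n => by simpa using (pow_ne_zero n hp0).symm) (fun a ha => ?_) hx
    (analyticAt_doubleSum_sub_closedForm hq0 hqy hy hqz hz hx hθ hθx).continuousAt)
  · by_cases h : theta a q = 0
    · obtain ⟨b, hb, n, hn⟩ := exists_eq_sq_zpow_mul_of_theta_eq_zero hq0 hq1 h
      exact Or.inr ⟨b, hb.imp_right Or.inl, n, hn⟩
    by_cases h' : theta (-a) (q ^ 2) = 0
    · obtain ⟨n, hn⟩ := (theta_eq_zero_iff hp0 hp1).1 h'
      exact Or.inr ⟨-1, by simp, n, by linear_combination -hn⟩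
    exact Or.inl (analyticAt_doubleSum_sub_closedForm hq0 hqy hy hqz hz ha h h')
  · filter_upwards [(eventually_ne_nhds ha).filter_mono nhdsWithin_le_nhds,
      eventually_theta_ne_zero hq0 hq1 ha,
      eventually_theta_const_mul_ne_zero hp0 hp1 (neg_ne_zero.2 one_ne_zero) ha] with w hw hθw hθw'
    exact doubleSum_sub_closedForm_mul_sq hq0 hqy hy hqz hz hw hθw (by rwa [← neg_one_mul])

end ClosedForm

end AppellLerch

end

open Kronecker AppellLerch in
theorem theorem1 (q x y z : ℂ) (hq0 : q ≠ 0) (hq1 : ‖q‖ < 1)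
    (hqy : ‖q‖ < ‖y‖) (hy : ‖y‖ < 1) (hqz : ‖q‖ < ‖z‖) (hz : ‖z‖ < 1)
    (hx0 : x ≠ 0) (hx : ∀ n : ℤ, x ≠ q ^ n) :
    -- both halves of the double sum converge absolutely
    Summable (Kronecker.termNonneg q x y z) ∧
    Summable (Kronecker.termNeg q x y z) ∧
    -- the identity, wherever no denominator on the right-hand side vanishes
    ((∀ k : ℤ, x ≠ -q ^ (2 * k)) →
      Summable (Kronecker.lerchTerm q (y * z) x) ∧
      Summable (Kronecker.lerchTerm q (x * y) z) ∧
      Summable (Kronecker.lerchTerm q (x * z) y) ∧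
      Kronecker.doubleSum q x y z = Kronecker.closedForm q x y z) ∧
    -- at the remaining points the right-hand side has a removable singularity in `x`,
    -- and the identity holds with its limit there
    ((∃ k : ℤ, x = -q ^ (2 * k)) →
      Tendsto (fun w : ℂ => Kronecker.closedForm q w y z) (𝓝[≠] x)
        (𝓝 (Kronecker.doubleSum q x y z))) := by
  have hy0 := norm_pos_iff.1 ((norm_nonneg q).trans_lt hqy)
  have hz0 := norm_pos_iff.1 ((norm_nonneg q).trans_lt hqz)
  have hp0 := pow_ne_zero 2 hq0
  have hp1 := norm_sq_lt_one hq1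
  have hθ : theta x q ≠ 0 := by simpa [theta_eq_zero_iff hq0 hq1] using hx
  refine ⟨(summable_norm_termNonneg hq0 hq1 hy hz hx0).of_norm,
    (summable_norm_termNeg hq0 hq1 hqy hqz hx0).of_norm, fun hx' => ?_, fun _ => ?_⟩
  · have hθ' : theta (-x) (q ^ 2) ≠ 0 := by
      simpa [theta_eq_zero_iff hp0 hp1, neg_eq_iff_eq_neg, zpow_mul, zpow_ofNat] using hx'
    exact ⟨(summable_norm_lerchTerm hq0 hq1 _ hx0).of_norm,
      (summable_norm_lerchTerm hq0 hq1 _ hz0).of_norm,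
      (summable_norm_lerchTerm hq0 hq1 _ hy0).of_norm,
      doubleSum_eq_closedForm hq0 hqy hy hqz hz hx0 hθ hθ'⟩
  · refine ((analyticAt_doubleSum hq0 hqy hy hqz hz hx0 fun e _ =>
      (theta_ne_zero_iff hq0 hq1).1 hθ e).continuousAt.tendsto.mono_left
        nhdsWithin_le_nhds).congr' ?_
    filter_upwards [(eventually_ne_nhds hx0).filter_mono nhdsWithin_le_nhds,
      eventually_theta_ne_zero hq0 hq1 hx0, eventually_theta_const_mul_ne_zero hp0 hp1
        (neg_ne_zero.2 one_ne_zero) hx0] with w hw hθw hθw'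
    exact doubleSum_eq_closedForm hq0 hqy hy hqz hz hw hθw (by rwa [← neg_one_mul])
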